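/- **Theorem (sparse Gaussian additive model, positive result).** *Model.* For integers $1\le k\le p$ let $\mathcal X_{p,k}$ be the set of vectors in $\{0,1\}^p$ with exactly $k$ ones, and let $G_{p,k}$ be the Johnson graph on it ($x,y$ are adjacent iff they differ in exactly two entries). Let $f:[-1,1]\to\mathbb R$ be independent of $p$, and for each $p$ let $F=F_p:\mathbb S^{p-1}\to\mathbb R^{d}$, $d=d_p$, satisfy $\langle F(a),F(b)\rangle=f(\langle a,b\rangle)$ for all $a,b\in\mathbb S^{p-1}$. Let $v^*$ be uniform on $\mathcal X_{p,k}$, let $W\sim N(0,I_d)$ be independent of $v^*$, and for $\lambda=\lambda_p>0$ let $$Y=\lambda F(v^*/\sqrt k)+W,\qquad H(x)=\langle F(x/\sqrt k),Y\rangle\quad(x\in\mathcal X_{p,k}).$$ *Chain.* For $\beta>0$ the Metropolis chain on $G_{p,k}$ at inverse temperature $\beta$ proposes in each step a uniformly random neighbour $y$ of the current state $x$ and moves to it with probability $\min\{1,\pi_\beta(y)/\pi_\beta(x)\}$, where $\pi_\beta(x)\propto e^{\beta H(x)}$; otherwise it stays at $x$. Randomized greedy ($\beta=\infty$) accepts the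 proposal iff $H(y)\ge H(x)$. The initial state $X_0$ is uniform on $\mathcal X_{p,k}$. The chain *finds $v^*$ within $N$ iterations with probability at least $2/3$* if, given $(v^*,W)$, the conditional probability that $X_i=v^*$ for some $i\le N$ is at least $2/3$. *Assumption on $f$.* There are constants $\varepsilon\in(0,1)$, $t\ge1$, $c>0$ and $M$ such that $f\in C^2[0,1]$ is monotone increasing and convex on $[0,1]$, $f(0)=0$, $f(1)\le M$, $f'(x)\ge c\,x^{t-1}$ for $x\in[0,\varepsilon]$, $f'(1)\le M$, and $f''(x)\le M$ for $x\in[1-\varepsilon,1]$. *Typical overlap.* Let $k=k_p$, with $1\le k\le p$ for all large $p$. If $k=O(\sqrt{p\log p})$, put $\ell_{p,k}=1$; if $k=\omega(\sqrt{p\log p})$, put $\ell_{p,k}=k^2/p$. One of the two is assumed to hold. *Claim.* There are positive constants $C_\lambda,C_\beta,C_T$ and, for each $\eta>0$, a positive constant $C'_\beta(\eta)$, all depending only on $\varepsilon,t,c,M$ (and $C'_\beta$ also on $\eta$), such that the following holds for all $f,F_p,k_p,\lambda_p$ as above with $$\lambda\ \ge\ C_\lambda\,\frac{k^{t-1/2}}{\ell_{p,k}^{\,t-1}}\sqrt{\log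 p}\qquad\text{for all large } p.$$ 1. With probability over $(v^*,W)$ tending to $1$ as $p\to\infty$: for every $\beta$ with $\beta\lambda\ge C_\beta\,\dfrac{k^{t}}{\ell_{p,k}^{\,t-1}}\log p$, the Metropolis chain started at random finds $v^*$ within $C_T\,\beta\lambda k^2p$ iterations with probability at least $2/3$. 2. If moreover $k\le(1-\eta)p$ for all large $p$, for some fixed $\eta>0$ (in particular if $k=o(p)$), then with probability over $(v^*,W)$ tending to $1$: for every $\beta$ with $\beta\lambda\ge C'_\beta(\eta)\,\dfrac{k^{t+1}}{\ell_{p,k}^{\,t-1}}\log(p/k)$, the Metropolis chain started at random finds $v^*$ within $C_T\,\dfrac{k^{t+1}}{\ell_{p,k}^{\,t-1}}\,p$ iterations with probability at least $2/3$. 3. With probability over $(v^*,W)$ tending to $1$, randomized greedy started at random finds $v^*$ within $C_T\,\dfrac{k^{t+1}}{\ell_{p,k}^{\,t-1}}\,p$ iterations with probability at least $2/3$. -/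

import Mathlib

open MeasureTheory ProbabilityTheory Filter Topology Asymptotics

noncomputable section

namespace SparseGAM

/-! ### Finite Markov chains and the Metropolis chain -/

section Chain

variable {V : Type*} [Fintype V]

/-- Probability that a Markov chain `X 0, X 1, …` on the finite state space `V`, with initial
distribution `init` and transition probabilities `P x y`, has `X i = ω i` for all `i ≤ N`. -/
def pathProb (init : V → ℝ) (P : V → V → ℝ) (N : ℕ) (ω : Fin (N + 1) → V) : ℝ :=
  init (ω 0) * ∏ i : Fin N, P (ω i.castSucc) (ω i.succ)

open Classical in
/-- Probability that this chain visits `v` within the first `N` iterations, i.e. that `X i = v`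
for some `i ≤ N`: the total mass of the trajectories of length `N` through `v`. -/
def hitProb (init : V → ℝ) (P : V → V → ℝ) (v : V) (N : ℕ) : ℝ :=
  ∑ ω : Fin (N + 1) → V, if ∃ i, ω i = v then pathProb init P N ω else 0

/-- The uniform initial distribution. -/
def uniformInit (V : Type*) [Fintype V] : V → ℝ := fun _ => 1 / (Fintype.card V : ℝ)

open Classical in
/-- One step of the chain on `G` with acceptance probabilities `a`: with probability
`1 - deg x / Δ` stay at `x`, otherwise propose a uniformly random neighbour `y` of `x` and move
there with probability `a x y` (and stay at `x` if not). So each neighbour is proposed with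
probability `1 / Δ`, where `Δ` is the maximum degree of `G`. -/
def proposalChain (G : SimpleGraph V) (a : V → V → ℝ) (x y : V) : ℝ :=
  if x = y then 1 - ∑ z, (if G.Adj x z then 1 / (G.maxDegree : ℝ) * a x z else 0)
  else if G.Adj x y then 1 / (G.maxDegree : ℝ) * a x y else 0

/-- The Gibbs distribution `π_β(x) ∝ exp (β H x)`. -/
def gibbs (H : V → ℝ) (β : ℝ) (x : V) : ℝ :=
  Real.exp (β * H x) / ∑ z, Real.exp (β * H z)

/-- The Metropolis chain on `G` at inverse temperature `β`: a proposed move from `x` to `y` is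
accepted with probability `min {1, π_β(y) / π_β(x)}`. -/
def metropolis (G : SimpleGraph V) (H : V → ℝ) (β : ℝ) : V → V → ℝ :=
  proposalChain G fun x y => min 1 (gibbs H β y / gibbs H β x)

open Classical in
/-- Randomized greedy, the Metropolis chain with `β = ∞`: a proposed move is accepted exactly when
it does not decrease `H`. -/
def randomizedGreedy (G : SimpleGraph V) (H : V → ℝ) : V → V → ℝ :=
  proposalChain G fun x y => if H x ≤ H y then 1 else 0

end Chain

/-! ### The sparse Gaussian additive model -/

/-- `𝒳_{p,k}`, the `k`-sparse binary vectors of length `p`, identified with their supports. -/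
abbrev SparseSet (p k : ℕ) : Type := {x : Finset (Fin p) // x.card = k}

/-- The normalized binary vector `x / √k`. -/
def normalizedVec {p k : ℕ} (x : SparseSet p k) : EuclideanSpace ℝ (Fin p) :=
  (1 / √(k : ℝ)) • WithLp.toLp 2 fun i => if i ∈ x.1 then (1 : ℝ) else 0

/-- The Johnson graph: two `k`-sparse vectors are adjacent iff they differ in exactly two
entries. -/
def johnsonGraph (p k : ℕ) : SimpleGraph (SparseSet p k) where
  Adj x y := (symmDiff x.1 y.1).card = 2
  symm := ⟨fun x y h => by rwa [symmDiff_comm]⟩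
  loopless := ⟨fun x h => by simp at h⟩

/-- `⟨F a, F b⟩ = f ⟨a, b⟩` for all unit vectors `a`, `b`. -/
def IsFeatureMap {p d : ℕ} (f : ℝ → ℝ)
    (F : EuclideanSpace ℝ (Fin p) → EuclideanSpace ℝ (Fin d)) : Prop :=
  ∀ a b, ‖a‖ = 1 → ‖b‖ = 1 → inner ℝ (F a) (F b) = f (inner ℝ a b)

/-- The observation `Y = λ F(v / √k) + W` with signal `v` and noise `W`. -/
def observation {p d k : ℕ} (F : EuclideanSpace ℝ (Fin p) → EuclideanSpace ℝ (Fin d)) (lam : ℝ)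
    (v : SparseSet p k) (W : EuclideanSpace ℝ (Fin d)) : EuclideanSpace ℝ (Fin d) :=
  lam • F (normalizedVec v) + W

/-- The Hamiltonian `H(x) = ⟨F(x / √k), Y⟩`. -/
def hamiltonian {p d k : ℕ} (F : EuclideanSpace ℝ (Fin p) → EuclideanSpace ℝ (Fin d))
    (Y : EuclideanSpace ℝ (Fin d)) (x : SparseSet p k) : ℝ :=
  inner ℝ (F (normalizedVec x)) Y

/-- The joint law of the signal `v*`, uniform on `𝒳_{p,k}`, and the independent noise `W`, a vector
of i.i.d. standard Gaussians. -/
def law (p k d : ℕ) : Measure (SparseSet p k × EuclideanSpace ℝ (Fin d)) :=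
  (uniformOn Set.univ).prod (stdGaussian (EuclideanSpace ℝ (Fin d)))

/-- The events `E p` hold with high probability as `p → ∞`. (The complement is measured, so that
for a set that might not be measurable this is the stronger reading.) -/
def WithHighProbability {Ω : ℕ → Type*} [∀ p, MeasurableSpace (Ω p)] (μ : ∀ p, Measure (Ω p))
    (E : ∀ p, Ω p → Prop) : Prop :=
  Tendsto (fun p => μ p {ω | ¬ E p ω}) atTop (𝓝 0)

/-- The assumption on the link function, with its implied constants made explicit: `c` is the one
in the lower bound `f'(x) = Ω(x^{t-1})`, and `M` the one in the upper bounds `O(1)`. -/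
structure LinkAssumption (f : ℝ → ℝ) (ε t c M : ℝ) : Prop where
  contDiffOn : ContDiffOn ℝ 2 f (Set.Icc 0 1)
  monotoneOn : MonotoneOn f (Set.Icc 0 1)
  convexOn : ConvexOn ℝ (Set.Icc 0 1) f
  map_zero : f 0 = 0
  map_one_le : f 1 ≤ M
  le_deriv : ∀ x ∈ Set.Icc 0 ε, c * x ^ (t - 1) ≤ derivWithin f (Set.Icc 0 1) x
  deriv_one_le : derivWithin f (Set.Icc 0 1) 1 ≤ M
  deriv_two_le : ∀ x ∈ Set.Icc (1 - ε) 1, iteratedDerivWithin 2 f (Set.Icc 0 1) x ≤ M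

/-- The sparse regime `k = O(√(p log p))`. -/
def SparseRegime (k : ℕ → ℕ) : Prop :=
  (fun p => (k p : ℝ)) =O[atTop] fun p : ℕ => √((p : ℝ) * Real.log p)

/-- The dense regime `k = ω(√(p log p))`. -/
def DenseRegime (k : ℕ → ℕ) : Prop :=
  (fun p : ℕ => √((p : ℝ) * Real.log p)) =o[atTop] fun p => (k p : ℝ)

open Classical in
/-- The typical overlap `ℓ_{p,k}`: it is `1` in the sparse regime and `k² / p` in the dense one. -/
def typicalOverlap (k : ℕ → ℕ) (p : ℕ) : ℝ :=
  if SparseRegime k then 1 else (k p : ℝ) ^ 2 / p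

end SparseGAM

end

noncomputable section

namespace SparseGAM

/-! ### Finite Markov chains -/

section Markov

/-! Write `ℓ` for the typical overlap and `m = k - overlap x v`, where `v` is the signal. While the
overlap is at least of order `ℓ`, each of the `m ^ 2` swaps from `x` towards `v` raises the signal
part of `H` by order `λ ℓ^(t-1) / k^t`, by convexity and the lower bound on `f'`.

Noise. One swap changes the noise by order `1 / √k`, but there are too many states to ask that every
swap be good. It is enough that no state has more than one eighth of its upward swaps spoiled.
Otherwise the spoiled swaps contain a matching of size at least `m / 16`. Increments along a
matching are almost uncorrelated, because their covariances are second differences of `f` at `1`, of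
order at most `1 / k²`. So `norm_incrementSum_sq_le` gives a variance linear in the size of the
matching, and the Gaussian tail beats a union bound over states and matchings
(`measure_badMoves_le`).

Dynamics. The chain may also accept swaps that do not approach `v`, so it is not followed move by
move. Progress is measured by the entropy of its law relative to the Gibbs measure. This is at most
`β` times the oscillation of `H` at the start, never becomes negative, and by reversibility drops by
order `β δ / Δ` in each step in which a constant mass sits at states other than `v` with a move
gaining `δ` (`relEntropy_step`). Here `Δ` is the maximum degree. If `v` were not found with
probability `2/3`, such mass would be present at all times and the entropy would be exhausted
(`two_thirds_le_hitProb_metropolis`).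

In the dense regime the chain must also keep its overlap above about `ℓ / 2`. It starts there by
Chebyshev, and since most upward swaps are accepted, an exponential of the overlap is nearly a
supermartingale (`sum_chainLaw_low_overlap_le`).

The resulting number of steps does not depend on `β`, so letting `β → ∞` gives randomized greedy. -/

lemma pathProb_snoc {V : Type*} (init : V → ℝ) (P : V → V → ℝ) (N : ℕ) (ω : Fin (N + 1) → V) (y : V) :
    pathProb init P (N + 1) (Fin.snoc ω y : Fin (N + 2) → V) =
      pathProb init P N ω * P (ω (Fin.last N)) y := by
  have h0 : (Fin.snoc ω y : Fin (N + 2) → V) 0 = ω 0 := by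
    rw [← Fin.castSucc_zero, Fin.snoc_castSucc (α := fun _ => V)]
  simp only [pathProb, h0]
  rw [Fin.prod_univ_castSucc, mul_assoc]
  congr 2
  · refine Finset.prod_congr rfl fun i _ => ?_
    rw [Fin.succ_castSucc, Fin.snoc_castSucc (α := fun _ => V),
      Fin.snoc_castSucc (α := fun _ => V)]
  · rw [Fin.succ_last, Fin.snoc_castSucc (α := fun _ => V), Fin.snoc_last (α := fun _ => V)]

lemma continuous_pathProb_left {V : Type*} (N : ℕ) (init : V → ℝ) (ω : Fin (N + 1) → V) :
    Continuous fun P : V → V → ℝ => pathProb init P N ω := by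
  unfold pathProb
  fun_prop

variable {V : Type*} [Fintype V]

/-- A transition matrix with nonnegative entries and row sums one. -/
structure IsStochastic (P : V → V → ℝ) : Prop where
  nonneg : ∀ x y, 0 ≤ P x y
  sum_eq_one : ∀ x, ∑ y, P x y = 1

/-- The law of the chain after `n` steps. -/
def chainLaw (init : V → ℝ) (P : V → V → ℝ) : ℕ → V → ℝ
  | 0 => init
  | n + 1 => fun y => ∑ x, chainLaw init P n x * P x y

lemma chainLaw_nonneg {init : V → ℝ} {P : V → V → ℝ} (hi : ∀ x, 0 ≤ init x)
    (hP : IsStochastic P) (n : ℕ) (x : V) : 0 ≤ chainLaw init P n x := by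
  induction n generalizing x with
  | zero => exact hi x
  | succ n ih => exact Finset.sum_nonneg fun y _ => mul_nonneg (ih y) (hP.nonneg y x)

lemma sum_chainLaw_succ {init : V → ℝ} {P : V → V → ℝ} (n : ℕ) (g : V → ℝ) :
    ∑ y, chainLaw init P (n + 1) y * g y = ∑ x, chainLaw init P n x * ∑ y, P x y * g y := by
  simp only [chainLaw, Finset.sum_mul, Finset.mul_sum]
  rw [Finset.sum_comm]
  simp only [mul_assoc]

lemma sum_chainLaw {init : V → ℝ} {P : V → V → ℝ} (hi : ∑ x, init x = 1)
    (hP : IsStochastic P) (n : ℕ) : ∑ x, chainLaw init P n x = 1 := by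
  induction n with
  | zero => exact hi
  | succ n ih =>
    have := sum_chainLaw_succ (init := init) (P := P) n (fun _ => 1)
    simpa [hP.sum_eq_one, ih] using this

lemma sum_path_succ (N : ℕ) (g : (Fin (N + 2) → V) → ℝ) :
    ∑ ω, g ω = ∑ ω : Fin (N + 1) → V, ∑ y, g (Fin.snoc ω y : Fin (N + 2) → V) := by
  rw [← (Fin.snocEquiv (fun _ : Fin (N + 2) => V)).sum_comp, Fintype.sum_prod_type,
    Finset.sum_comm]
  rfl

lemma pathProb_nonneg {init : V → ℝ} {P : V → V → ℝ} (hi : ∀ x, 0 ≤ init x)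
    (hP : IsStochastic P) (N : ℕ) (ω : Fin (N + 1) → V) : 0 ≤ pathProb init P N ω :=
  mul_nonneg (hi _) (Finset.prod_nonneg fun _ _ => hP.nonneg _ _)

lemma sum_pathProb_last {init : V → ℝ} {P : V → V → ℝ} (N : ℕ) (g : V → ℝ) :
    ∑ ω, pathProb init P N ω * g (ω (Fin.last N)) = ∑ x, chainLaw init P N x * g x := by
  induction N generalizing g with
  | zero =>
    rw [← (Equiv.funUnique (Fin 1) V).symm.sum_comp]
    simp [pathProb, chainLaw]
  | succ N ih =>
    rw [sum_path_succ, sum_chainLaw_succ, ← ih]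
    refine Finset.sum_congr rfl fun ω _ => ?_
    rw [Finset.mul_sum]
    refine Finset.sum_congr rfl fun y _ => ?_
    rw [pathProb_snoc, Fin.snoc_last (α := fun _ => V), mul_assoc]

lemma hitProb_le_succ {init : V → ℝ} {P : V → V → ℝ} (hi : ∀ x, 0 ≤ init x)
    (hP : IsStochastic P) (v : V) (N : ℕ) :
    hitProb init P v N ≤ hitProb init P v (N + 1) := by
  classical
  unfold hitProb
  rw [sum_path_succ]
  refine Finset.sum_le_sum fun ω _ => ?_
  split_ifs with h
  · obtain ⟨i, hi'⟩ := h
    have : ∀ y, (∃ j, (Fin.snoc ω y : Fin (N + 2) → V) j = v) := fun y =>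
      ⟨i.castSucc, by rw [Fin.snoc_castSucc (α := fun _ => V), hi']⟩
    simp only [this, if_true, pathProb_snoc]
    rw [← Finset.mul_sum, hP.sum_eq_one, mul_one]
  · refine Finset.sum_nonneg fun y _ => ?_
    split_ifs
    exacts [pathProb_nonneg hi hP _ _, le_rfl]

lemma hitProb_mono {init : V → ℝ} {P : V → V → ℝ} (hi : ∀ x, 0 ≤ init x)
    (hP : IsStochastic P) (v : V) : Monotone (hitProb init P v) :=
  monotone_nat_of_le_succ fun N => hitProb_le_succ hi hP v N

lemma chainLaw_le_hitProb {init : V → ℝ} {P : V → V → ℝ} (hi : ∀ x, 0 ≤ init x)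
    (hP : IsStochastic P) (v : V) {n N : ℕ} (hn : n ≤ N) :
    chainLaw init P n v ≤ hitProb init P v N := by
  classical
  refine le_trans ?_ (hitProb_mono hi hP v hn)
  have := sum_pathProb_last (init := init) (P := P) n (fun x => if x = v then 1 else 0)
  simp only [mul_ite, mul_one, mul_zero, Finset.sum_ite_eq', Finset.mem_univ, if_true] at this
  rw [← this]
  unfold hitProb
  refine Finset.sum_le_sum fun ω _ => ?_
  by_cases h : ω (Fin.last n) = v
  · rw [if_pos h, if_pos ⟨_, h⟩]
  · rw [if_neg h]
    split_ifs
    exacts [pathProb_nonneg hi hP _ _, le_rfl]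

/-- If `φ` grows in mean by at most `e` per step then its mean after `n` steps has grown by at
most `n * e`. -/
lemma sum_chainLaw_mul_le {init : V → ℝ} {P : V → V → ℝ} (hi : ∀ x, 0 ≤ init x)
    (hi1 : ∑ x, init x = 1) (hP : IsStochastic P) {φ : V → ℝ} {e : ℝ}
    (hφ : ∀ x, ∑ y, P x y * φ y ≤ φ x + e) (n : ℕ) :
    ∑ x, chainLaw init P n x * φ x ≤ ∑ x, init x * φ x + n * e := by
  induction n with
  | zero => simp [chainLaw]
  | succ n ih =>
    rw [sum_chainLaw_succ]
    calc ∑ x, chainLaw init P n x * ∑ y, P x y * φ y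
        ≤ ∑ x, chainLaw init P n x * (φ x + e) :=
          Finset.sum_le_sum fun x _ =>
            mul_le_mul_of_nonneg_left (hφ x) (chainLaw_nonneg hi hP n x)
      _ = ∑ x, chainLaw init P n x * φ x + e := by
          simp only [mul_add, Finset.sum_add_distrib, ← Finset.sum_mul, sum_chainLaw hi1 hP,
            one_mul]
      _ ≤ _ := by push_cast; linarith

/-! ### Decay of relative entropy along a reversible chain -/

/-- The relative entropy of `μ` with respect to a positive weight `π`. -/
def relEntropy (μ π : V → ℝ) : ℝ := ∑ x, μ x * Real.log (μ x / π x)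

/-- Convex duality for `a log (a / b)`, with equality at `s = log (a / b)`. The free parameter `s`
allows a few chosen edges to be given extra weight. -/
lemma mul_log_div_ge {a b : ℝ} (ha : 0 < a) (hb : 0 < b) (s : ℝ) :
    a * s + a - b * Real.exp s ≤ a * Real.log (a / b) := by
  have h := Real.log_le_sub_one_of_pos (show 0 < b * Real.exp s / a by positivity)
  rw [Real.log_div (by positivity) ha.ne', Real.log_mul hb.ne' (Real.exp_pos s).ne',
    Real.log_exp] at h
  rw [Real.log_div ha.ne' hb.ne']
  have h2 := mul_le_mul_of_nonneg_left h ha.le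
  have h3 : a * (b * Real.exp s / a - 1) = b * Real.exp s - a := by field_simp
  nlinarith

lemma relEntropy_nonneg {μ π : V → ℝ} (hμ : ∀ x, 0 ≤ μ x) (hμ1 : ∑ x, μ x = 1)
    (hπ : ∀ x, 0 < π x) (hπ1 : ∑ x, π x = 1) : 0 ≤ relEntropy μ π := by
  have : ∑ x, (μ x - π x) ≤ relEntropy μ π := by
    refine Finset.sum_le_sum fun x _ => ?_
    rcases (hμ x).eq_or_lt with h | h
    · rw [← h]; simp [(hπ x).le]
    · simpa using mul_log_div_ge h (hπ x) 0
  simpa [Finset.sum_sub_distrib, hμ1, hπ1] using this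

open Classical in
/-- Decrease of the relative entropy in one step of a reversible chain, measured on the edges
`(x, up x)` with `x ∈ S`: these are traversed with probability at least `q` forwards and little
probability backwards. -/
lemma relEntropy_step {μ π : V → ℝ} {P : V → V → ℝ} (hμ : ∀ x, 0 ≤ μ x) (hμ1 : ∑ x, μ x = 1)
    (hπ : ∀ x, 0 < π x) (hP : IsStochastic P) (hrev : ∀ x y, π x * P x y = π y * P y x)
    {S : Finset V} {up : V → V} {q b L : ℝ} (hL : 0 ≤ L) (hq : ∀ x ∈ S, q ≤ P x (up x))
    (hb : ∀ y, ∑ x ∈ S.filter (fun x => up x = y), P y x ≤ b) :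
    relEntropy (fun y => ∑ x, μ x * P x y) π + L * q * ∑ x ∈ S, μ x - Real.exp L * b ≤
      relEntropy μ π := by
  set μ' : V → ℝ := fun y => ∑ x, μ x * P x y with hμ'
  have hμ'0 : ∀ y, 0 ≤ μ' y := fun y =>
    Finset.sum_nonneg fun x _ => mul_nonneg (hμ x) (hP.nonneg x y)
  have hμ'1 : ∑ y, μ' y = 1 := by
    simp only [hμ']
    rw [Finset.sum_comm]
    simp only [← Finset.mul_sum, hP.sum_eq_one, mul_one, hμ1]
  -- The dual test function: only the chosen edges `(x, up x)` count.
  let s : V → V → ℝ := fun x y => if x ∈ S ∧ y = up x then L else 0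
  have key : ∀ x y, μ x * P x y * s x y + μ x * P x y - μ' y * P y x * Real.exp (s x y) ≤
      μ x * P x y * (Real.log (μ x / π x) - Real.log (μ' y / π y)) := by
    intro x y
    have hA := mul_nonneg (hμ x) (hP.nonneg x y)
    rcases hA.eq_or_lt with h | h
    · rw [← h]
      have := mul_nonneg (mul_nonneg (hμ'0 y) (hP.nonneg y x)) (Real.exp_pos (s x y)).le
      simp only [zero_mul]
      linarith
    · have hx : 0 < μ x := (hμ x).lt_of_ne (by rintro h0; rw [← h0] at h; simp at h)
      have hxy : 0 < P x y := (hP.nonneg x y).lt_of_ne (by rintro h0; rw [← h0] at h; simp at h)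
      have hy : 0 < μ' y := h.trans_le (Finset.single_le_sum
        (f := fun x => μ x * P x y) (fun z _ => mul_nonneg (hμ z) (hP.nonneg z y))
        (Finset.mem_univ x))
      have hyx : 0 < P y x := by
        have h1 := hrev x y
        have h2 : 0 < π y * P y x := by rw [← h1]; exact mul_pos (hπ x) hxy
        exact pos_of_mul_pos_right h2 (hπ y).le
      -- Reversibility turns the change of the log-density along `(x, y)` into the ratio of the
      -- forward flow to the flow of the new law sent back along the same edge. The entropy drop is
      -- therefore a relative entropy between two flows.
      have e : Real.log (μ x / π x) - Real.log (μ' y / π y) =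
          Real.log (μ x * P x y / (μ' y * P y x)) := by
        rw [← Real.log_div (div_pos hx (hπ x)).ne' (div_pos hy (hπ y)).ne']
        congr 1
        have h1 := hrev x y
        have := (hπ x).ne'
        have := (hπ y).ne'
        field_simp
        linarith
      rw [e]
      exact mul_log_div_ge h (mul_pos hy hyx) _
  have hsum := Finset.sum_le_sum fun x (_ : x ∈ Finset.univ) =>
    Finset.sum_le_sum fun y (_ : y ∈ Finset.univ) => key x y
  simp only [Finset.sum_sub_distrib, Finset.sum_add_distrib, mul_sub] at hsum
  have e1 : ∑ x, ∑ y, μ x * P x y * Real.log (μ x / π x) = relEntropy μ π := by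
    refine Finset.sum_congr rfl fun x _ => ?_
    rw [← Finset.sum_mul, ← Finset.mul_sum, hP.sum_eq_one, mul_one]
  have e2 : ∑ x, ∑ y, μ x * P x y * Real.log (μ' y / π y) = relEntropy μ' π := by
    rw [Finset.sum_comm]
    refine Finset.sum_congr rfl fun x _ => ?_
    rw [← Finset.sum_mul]
  have e3 : ∑ x, ∑ y, μ x * P x y = 1 := by
    simp only [← Finset.mul_sum, hP.sum_eq_one, mul_one, hμ1]
  have e4 : L * q * ∑ x ∈ S, μ x ≤ ∑ x, ∑ y, μ x * P x y * s x y := by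
    have : ∀ x, ∑ y, μ x * P x y * s x y = if x ∈ S then L * P x (up x) * μ x else 0 := by
      intro x
      by_cases hx : x ∈ S
      · simp only [s, hx, true_and, mul_ite, mul_zero, Finset.sum_ite_eq', Finset.mem_univ,
          if_true]
        ring
      · simp [s, hx]
    simp only [this]
    rw [Finset.sum_ite_mem, Finset.univ_inter, Finset.mul_sum]
    refine Finset.sum_le_sum fun x hx => ?_
    exact mul_le_mul_of_nonneg_right (mul_le_mul_of_nonneg_left (hq x hx) hL) (hμ x)
  -- The backward flow has total mass one. The weight `exp L` adds at most `exp L * b` to it, since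
  -- from each `y` the chosen edges are traversed backwards with probability at most `b`.
  have e5 : ∑ x, ∑ y, μ' y * P y x * Real.exp (s x y) ≤ 1 + Real.exp L * b := by
    rw [Finset.sum_comm]
    have : ∀ y, ∑ x, μ' y * P y x * Real.exp (s x y) ≤ μ' y * (1 + Real.exp L * b) := by
      intro y
      simp only [mul_assoc]
      rw [← Finset.mul_sum]
      refine mul_le_mul_of_nonneg_left ?_ (hμ'0 y)
      have h1 : ∀ x, P y x * Real.exp (s x y) ≤
          P y x + (if x ∈ S ∧ up x = y then P y x * Real.exp L else 0) := by
        intro x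
        by_cases hx : x ∈ S ∧ y = up x
        · have hx' : x ∈ S ∧ up x = y := ⟨hx.1, hx.2.symm⟩
          simp only [s, if_pos hx, if_pos hx']
          linarith [hP.nonneg y x]
        · have hx' : ¬ (x ∈ S ∧ up x = y) := fun h => hx ⟨h.1, h.2.symm⟩
          simp only [s, if_neg hx, if_neg hx']
          simp
      refine (Finset.sum_le_sum fun x _ => h1 x).trans ?_
      rw [Finset.sum_add_distrib, hP.sum_eq_one]
      have h2 : ∑ x, (if x ∈ S ∧ up x = y then P y x * Real.exp L else 0) =
          Real.exp L * ∑ x ∈ S.filter (fun x => up x = y), P y x := by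
        rw [Finset.mul_sum, Finset.sum_filter]
        rw [← Finset.sum_subset (Finset.subset_univ S)]
        · refine Finset.sum_congr rfl fun x hx => ?_
          simp [hx, mul_comm]
        · intro x _ hx
          simp [hx]
      rw [h2]
      exact add_le_add_right (mul_le_mul_of_nonneg_left (hb y) (Real.exp_pos L).le) _
    refine (Finset.sum_le_sum fun y _ => this y).trans ?_
    rw [← Finset.sum_mul, hμ'1, one_mul]
  rw [e1, e2, e3] at hsum
  linarith

/-! ### Proposal chains and the Metropolis chain -/

lemma proposalChain_isStochastic (G : SimpleGraph V) {a : V → V → ℝ} (ha0 : ∀ x y, 0 ≤ a x y)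
    (ha1 : ∀ x y, a x y ≤ 1) : IsStochastic (proposalChain G a) := by
  classical
  have hsum : ∀ x, ∑ z, (if G.Adj x z then 1 / (G.maxDegree : ℝ) * a x z else 0) ≤ 1 := by
    intro x
    calc ∑ z, (if G.Adj x z then 1 / (G.maxDegree : ℝ) * a x z else 0)
        ≤ ∑ z, (if G.Adj x z then 1 / (G.maxDegree : ℝ) else 0) := by
          refine Finset.sum_le_sum fun z _ => ?_
          split_ifs
          · exact mul_le_of_le_one_right (by positivity) (ha1 x z)
          · exact le_rfl
      _ = (G.degree x : ℝ) * (1 / (G.maxDegree : ℝ)) := by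
          rw [← Finset.sum_filter, Finset.sum_const, nsmul_eq_mul,
            ← SimpleGraph.card_neighborFinset_eq_degree, SimpleGraph.neighborFinset_eq_filter]
      _ ≤ 1 := by
          rw [mul_one_div]
          refine div_le_one_of_le₀ ?_ (by positivity)
          exact_mod_cast G.degree_le_maxDegree x
  constructor
  · intro x y
    unfold proposalChain
    split_ifs
    · linarith [hsum x]
    · exact mul_nonneg (by positivity) (ha0 x y)
    · exact le_rfl
  · intro x
    rw [← Finset.add_sum_erase _ _ (Finset.mem_univ x)]
    have h1 : proposalChain G a x x =
        1 - ∑ z, (if G.Adj x z then 1 / (G.maxDegree : ℝ) * a x z else 0) := by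
      simp [proposalChain]
    have h2 : ∑ y ∈ Finset.univ.erase x, proposalChain G a x y =
        ∑ z, (if G.Adj x z then 1 / (G.maxDegree : ℝ) * a x z else 0) := by
      rw [← Finset.add_sum_erase _ _ (Finset.mem_univ x)]
      simp only [SimpleGraph.irrefl, if_false, zero_add]
      refine Finset.sum_congr rfl fun y hy => ?_
      rw [proposalChain, if_neg (Finset.ne_of_mem_erase hy).symm]
    rw [h1, h2]
    ring

open Classical in
lemma proposalChain_apply_of_adj (G : SimpleGraph V) (a : V → V → ℝ) {x y : V}
    (h : G.Adj x y) : proposalChain G a x y = 1 / (G.maxDegree : ℝ) * a x y := by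
  rw [proposalChain, if_neg h.ne, if_pos h]

open Classical in
/-- The mean increment of `φ` in one step of the chain is a sum over the neighbours. -/
lemma sum_proposalChain_mul (G : SimpleGraph V) {a : V → V → ℝ} (ha0 : ∀ x y, 0 ≤ a x y) (ha1 : ∀ x y, a x y ≤ 1) (φ : V → ℝ) (x : V) :
    ∑ y, proposalChain G a x y * φ y =
      φ x + 1 / (G.maxDegree : ℝ) * ∑ y ∈ G.neighborFinset x, a x y * (φ y - φ x) := by
  have hst := proposalChain_isStochastic G ha0 ha1
  have : ∑ y, proposalChain G a x y * φ y =
      φ x + ∑ y, proposalChain G a x y * (φ y - φ x) := by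
    simp only [mul_sub, Finset.sum_sub_distrib, ← Finset.sum_mul, hst.sum_eq_one]
    ring
  rw [this, Finset.mul_sum, SimpleGraph.neighborFinset_eq_filter, Finset.sum_filter]
  congr 1
  refine Finset.sum_congr rfl fun y _ => ?_
  by_cases hxy : x = y
  · subst hxy; simp
  · by_cases h : G.Adj x y
    · rw [if_pos h, proposalChain_apply_of_adj G a h]
      rw [mul_assoc]
    · rw [if_neg h]
      simp [proposalChain, hxy, h]

lemma gibbs_pos (H : V → ℝ) (β : ℝ) (x : V) : 0 < gibbs H β x :=
  div_pos (Real.exp_pos _) (Finset.sum_pos (fun _ _ => Real.exp_pos _) ⟨x, Finset.mem_univ x⟩)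

lemma sum_gibbs [Nonempty V] (H : V → ℝ) (β : ℝ) : ∑ x, gibbs H β x = 1 := by
  unfold gibbs
  rw [← Finset.sum_div]
  exact div_self (Finset.sum_pos (fun _ _ => Real.exp_pos _) Finset.univ_nonempty).ne'

lemma gibbs_div_gibbs (H : V → ℝ) (β : ℝ) (x y : V) :
    gibbs H β y / gibbs H β x = Real.exp (β * (H y - H x)) := by
  have : 0 < ∑ z, Real.exp (β * H z) :=
    Finset.sum_pos (fun _ _ => Real.exp_pos _) ⟨x, Finset.mem_univ x⟩
  rw [mul_sub, Real.exp_sub, gibbs, gibbs, div_div_div_cancel_right₀ this.ne']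

lemma metropolis_eq (G : SimpleGraph V) (H : V → ℝ) (β : ℝ) :
    metropolis G H β = proposalChain G fun x y => min 1 (Real.exp (β * (H y - H x))) := by
  simp only [metropolis, gibbs_div_gibbs]

lemma metropolis_isStochastic (G : SimpleGraph V) (H : V → ℝ) (β : ℝ) :
    IsStochastic (metropolis G H β) := by
  rw [metropolis_eq]
  exact proposalChain_isStochastic G (fun _ _ => le_min zero_le_one (Real.exp_pos _).le)
    fun _ _ => min_le_left _ _

/-- Across an edge both sides equal the smaller of the two Gibbs weights divided by the maximum
degree. -/
lemma metropolis_reversible (G : SimpleGraph V) (H : V → ℝ) (β : ℝ) (x y : V) :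
    gibbs H β x * metropolis G H β x y = gibbs H β y * metropolis G H β y x := by
  by_cases hxy : x = y
  · rw [hxy]
  · by_cases h : G.Adj x y
    · rw [metropolis, proposalChain_apply_of_adj _ _ h, proposalChain_apply_of_adj _ _ h.symm]
      have hx := gibbs_pos H β x
      have hy := gibbs_pos H β y
      have e1 : gibbs H β x * min 1 (gibbs H β y / gibbs H β x) =
          min (gibbs H β x) (gibbs H β y) := by
        rw [mul_min_of_nonneg _ _ hx.le, mul_one, mul_div_cancel₀ _ hx.ne']
      have e2 : gibbs H β y * min 1 (gibbs H β x / gibbs H β y) =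
          min (gibbs H β x) (gibbs H β y) := by
        rw [mul_min_of_nonneg _ _ hy.le, mul_one, mul_div_cancel₀ _ hy.ne', min_comm]
      rw [mul_left_comm, e1, mul_left_comm, e2]
    · have h' : ¬ G.Adj y x := fun h' => h h'.symm
      simp [metropolis, proposalChain, hxy, h, h', Ne.symm hxy]

/-! ### Hitting times at low temperature -/

lemma uniformInit_nonneg (x : V) : 0 ≤ uniformInit V x := by
  unfold uniformInit; positivity

lemma sum_uniformInit [Nonempty V] : ∑ x, uniformInit V x = 1 := by
  simp [uniformInit]

/-- The density of the uniform law relative to the Gibbs measure at `x` is the average over `z` of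
`exp (β * (H z - H x))`, hence at most `exp (β * B)`. -/
lemma relEntropy_uniformInit_le [Nonempty V] {H : V → ℝ} {β B : ℝ} (hβ : 0 ≤ β)
    (hB : ∀ x y, H y - H x ≤ B) : relEntropy (uniformInit V) (gibbs H β) ≤ β * B := by
  have hn : 0 < (Fintype.card V : ℝ) := by exact_mod_cast Fintype.card_pos
  have : ∀ x, Real.log (uniformInit V x / gibbs H β x) ≤ β * B := by
    intro x
    have hx := gibbs_pos H β x
    rw [← Real.log_exp (β * B)]
    refine Real.log_le_log (by unfold uniformInit; positivity) ?_
    unfold uniformInit gibbs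
    rw [div_div_eq_mul_div, div_le_iff₀ (Real.exp_pos _), ← Real.exp_add, one_div,
      inv_mul_le_iff₀ hn]
    calc ∑ z, Real.exp (β * H z) ≤ ∑ _z : V, Real.exp (β * B + β * H x) := by
          refine Finset.sum_le_sum fun z _ => Real.exp_le_exp.2 ?_
          nlinarith [mul_le_mul_of_nonneg_left (hB x z) hβ]
      _ = _ := by simp
  calc relEntropy (uniformInit V) (gibbs H β) ≤ ∑ x, uniformInit V x * (β * B) :=
        Finset.sum_le_sum fun x _ =>
          mul_le_mul_of_nonneg_left (this x) (uniformInit_nonneg x)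
    _ = β * B := by rw [← Finset.sum_mul, sum_uniformInit, one_mul]

open Classical in
/-- If from every state of `S` other than `v` the Hamiltonian can be increased by `δ` in one move,
and the chain is likely to be in `S` at each of the times before `N`, then the
low-temperature Metropolis chain finds `v` within `N` iterations. -/
theorem two_thirds_le_hitProb_metropolis [Nonempty V] (G : SimpleGraph V) {H : V → ℝ} {v : V}
    {β δ B : ℝ} {S : Finset V} {N : ℕ} (hβ : 0 < β) (hB : ∀ x y, H y - H x ≤ B)
    (hup : ∀ x ∈ S, x ≠ v → ∃ y, G.Adj x y ∧ H x + δ ≤ H y)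
    (hS : ∀ n < N, 5 / 6 ≤ ∑ x ∈ S, chainLaw (uniformInit V) (metropolis G H β) n x)
    (hcold : Real.exp (-(β * δ / 2)) * G.maxDegree ≤ β * δ / 24)
    (hN : G.maxDegree * B < N * (δ / 24)) :
    2 / 3 ≤ hitProb (uniformInit V) (metropolis G H β) v N := by
  by_contra hlt
  push Not at hlt
  set P := metropolis G H β with hPdef
  have hP : IsStochastic P := metropolis_isStochastic G H β
  have hi : ∀ x, 0 ≤ uniformInit V x := uniformInit_nonneg
  set Δ : ℝ := (G.maxDegree : ℝ) with hΔ
  set T := S.erase v with hT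
  -- If `v` is hit with probability below `2/3`, then at each time at least `5/6 - 2/3` of the mass
  -- lies in `S` away from `v`.
  have hmass : ∀ n < N, 1 / 6 ≤ ∑ x ∈ T, chainLaw (uniformInit V) P n x := by
    intro n hn
    have h2 := chainLaw_le_hitProb hi hP v hn.le
    have h3 := hS n hn
    have h5 : ∑ x ∈ S, chainLaw (uniformInit V) P n x ≤
        ∑ x ∈ T, chainLaw (uniformInit V) P n x + chainLaw (uniformInit V) P n v := by
      by_cases hv : v ∈ S
      · rw [hT, Finset.sum_erase_add _ _ hv]
      · rw [hT, Finset.erase_eq_of_notMem hv]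
        linarith [chainLaw_nonneg hi hP n v]
    linarith
  have hNpos : 0 < N := by
    rcases Nat.eq_zero_or_pos N with h0 | h0
    · exfalso
      obtain ⟨x⟩ := (inferInstance : Nonempty V)
      have hB0 : 0 ≤ B := by simpa using hB x x
      rw [h0, Nat.cast_zero, zero_mul] at hN
      have : 0 ≤ Δ * B := mul_nonneg (by positivity) hB0
      linarith
    · exact h0
  have hTne : T.Nonempty := by
    by_contra hne
    rw [Finset.not_nonempty_iff_eq_empty] at hne
    have := hmass 0 hNpos
    rw [hne, Finset.sum_empty] at this
    norm_num at this
  choose! up hadj hgain using hup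
  have hTS : ∀ x ∈ T, x ∈ S ∧ x ≠ v := fun x hx =>
    ⟨Finset.mem_of_mem_erase hx, Finset.ne_of_mem_erase hx⟩
  have hΔpos : 0 < Δ := by
    obtain ⟨x, hx⟩ := hTne
    have h1 : 0 < G.degree x :=
      (G.degree_pos_iff_exists_adj x).2 ⟨_, hadj x (hTS x hx).1 (hTS x hx).2⟩
    exact Nat.cast_pos.2 (h1.trans_le (G.degree_le_maxDegree x))
  have hβδ : 0 < β * δ := by
    have h1 : 0 < Real.exp (-(β * δ / 2)) * Δ := mul_pos (Real.exp_pos _) hΔpos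
    linarith
  have hδ : 0 < δ := pos_of_mul_pos_right hβδ hβ.le
  have hq : ∀ x ∈ T, 1 / Δ ≤ P x (up x) := by
    intro x hx
    rw [hPdef, metropolis_eq, proposalChain_apply_of_adj _ _ (hadj x (hTS x hx).1 (hTS x hx).2),
      min_eq_left, mul_one]
    refine Real.one_le_exp (mul_nonneg hβ.le ?_)
    linarith [hgain x (hTS x hx).1 (hTS x hx).2]
  -- At most `Δ` chosen edges end at `y`, and each is traversed backwards with probability at most
  -- `exp (-(β * δ)) / Δ`.
  have hb : ∀ y, ∑ x ∈ T.filter (fun x => up x = y), P y x ≤ Real.exp (-(β * δ)) := by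
    intro y
    have hsub : T.filter (fun x => up x = y) ⊆ G.neighborFinset y := by
      intro x hx
      rw [Finset.mem_filter] at hx
      rw [SimpleGraph.mem_neighborFinset]
      have := hadj x (hTS x hx.1).1 (hTS x hx.1).2
      rw [hx.2] at this
      exact this.symm
    calc ∑ x ∈ T.filter (fun x => up x = y), P y x
        ≤ ∑ x ∈ T.filter (fun x => up x = y), 1 / Δ * Real.exp (-(β * δ)) := by
          refine Finset.sum_le_sum fun x hx => ?_
          have hx' := (Finset.mem_filter.1 hx)
          have h1 := (G.mem_neighborFinset y x).1 (hsub hx)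
          have h2 := hgain x (hTS x hx'.1).1 (hTS x hx'.1).2
          rw [hx'.2] at h2
          rw [hPdef, metropolis_eq, proposalChain_apply_of_adj _ _ h1]
          refine mul_le_mul_of_nonneg_left ((min_le_right _ _).trans ?_) (by positivity)
          refine Real.exp_le_exp.2 ?_
          have := mul_le_mul_of_nonneg_left (show H x - H y ≤ -δ by linarith) hβ.le
          linarith
      _ ≤ Δ * (1 / Δ * Real.exp (-(β * δ))) := by
          rw [Finset.sum_const, nsmul_eq_mul]
          refine mul_le_mul_of_nonneg_right ?_ (by positivity)
          have h1 := Finset.card_le_card hsub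
          rw [G.card_neighborFinset_eq_degree] at h1
          exact Nat.cast_le.2 (h1.trans (G.degree_le_maxDegree y))
      _ = Real.exp (-(β * δ)) := by field_simp
  have hdec : ∀ n ≤ N, relEntropy (chainLaw (uniformInit V) P n) (gibbs H β) +
      n * (β * δ / (24 * Δ)) ≤ β * B := by
    intro n
    induction n with
    | zero =>
      intro _
      simpa [chainLaw] using relEntropy_uniformInit_le hβ.le hB
    | succ n ih =>
      intro hn
      have h0 := ih (Nat.le_of_succ_le hn)
      -- With `L = β * δ / 2` the gain is at least `β * δ / (12 * Δ)` and the loss is `exp (-(β * δ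
      -- / 2))`; by `hcold` the loss is at most half of that gain.
      have h1 := relEntropy_step (chainLaw_nonneg hi hP n)
        (sum_chainLaw (sum_uniformInit (V := V)) hP n) (gibbs_pos H β) hP
        (metropolis_reversible G H β) (half_pos hβδ).le hq hb
      have h2 := mul_le_mul_of_nonneg_left (hmass n hn)
        (show 0 ≤ β * δ / 2 * (1 / Δ) by positivity)
      have h3 : Real.exp (β * δ / 2) * Real.exp (-(β * δ)) = Real.exp (-(β * δ / 2)) := by
        rw [← Real.exp_add]; congr 1; ring
      rw [h3] at h1
      have h4 : Real.exp (-(β * δ / 2)) ≤ β * δ / (24 * Δ) := by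
        rw [mul_comm 24 Δ, ← div_div, le_div_iff₀' (by norm_num : (0 : ℝ) < 24)] at *
        rw [le_div_iff₀ hΔpos]
        linarith
      have h5 : β * δ / 2 * (1 / Δ) * (1 / 6) = 2 * (β * δ / (24 * Δ)) := by field_simp; norm_num
      change relEntropy (fun y => ∑ x, chainLaw (uniformInit V) P n x * P x y) (gibbs H β) + _ ≤ _
      push_cast
      linarith
  have hfin := hdec N le_rfl
  have hnn := relEntropy_nonneg (chainLaw_nonneg hi hP N)
    (sum_chainLaw (sum_uniformInit (V := V)) hP N) (gibbs_pos H β) (sum_gibbs H β)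
  have h1 : N * (β * δ / (24 * Δ)) ≤ β * B := by linarith
  have h2 : N * (β * δ / (24 * Δ)) = β * (N * (δ / 24)) / Δ := by field_simp
  rw [h2, div_le_iff₀ hΔpos] at h1
  have h3 := mul_lt_mul_of_pos_left hN hβ
  nlinarith

/-! ### The zero-temperature limit -/

lemma continuous_hitProb (N : ℕ) (init : V → ℝ) (v : V) :
    Continuous fun P : V → V → ℝ => hitProb init P v N := by
  unfold hitProb
  refine continuous_finsetSum _ fun ω _ => ?_
  split_ifs
  exacts [continuous_pathProb_left N init ω, continuous_const]

/-- Moves that do not decrease `H`, ties included, are accepted with probability one for every `β ≥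
0`, and strictly decreasing moves have vanishing acceptance. This matches the non-strict rule of
randomized greedy. -/
lemma tendsto_metropolis_atTop (G : SimpleGraph V) (H : V → ℝ) :
    Tendsto (fun β => metropolis G H β) atTop (𝓝 (randomizedGreedy G H)) := by
  classical
  have hacc : ∀ x y, Tendsto (fun β => min 1 (Real.exp (β * (H y - H x)))) atTop
      (𝓝 (if H x ≤ H y then 1 else 0)) := by
    intro x y
    split_ifs with h
    · refine tendsto_const_nhds.congr' ?_
      filter_upwards [eventually_ge_atTop 0] with β hβ
      rw [min_eq_left]
      exact Real.one_le_exp (mul_nonneg hβ (sub_nonneg.2 h))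
    · have h1 : Tendsto (fun β => Real.exp (β * (H y - H x))) atTop (𝓝 0) :=
        Real.tendsto_exp_atBot.comp
          (tendsto_id.atTop_mul_const_of_neg (sub_neg.2 (not_le.1 h)))
      have := (tendsto_const_nhds (x := (1 : ℝ)) (f := atTop)).min h1
      simpa using this
  refine tendsto_pi_nhds.2 fun x => tendsto_pi_nhds.2 fun y => ?_
  simp only [metropolis_eq, randomizedGreedy, proposalChain]
  by_cases hxy : x = y
  · simp only [if_pos hxy]
    refine tendsto_const_nhds.sub (tendsto_finsetSum _ fun z _ => ?_)
    by_cases h : G.Adj x z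
    · simp only [if_pos h]
      exact (hacc x z).const_mul _
    · simp only [if_neg h]
      exact tendsto_const_nhds
  · simp only [if_neg hxy]
    by_cases h : G.Adj x y
    · simp only [if_pos h]
      exact (hacc x y).const_mul _
    · simp only [if_neg h]
      exact tendsto_const_nhds

end Markov

/-! ### The Johnson graph -/

section Johnson

variable {p k : ℕ}

/-- The overlap of two sparse vectors. -/
def overlap (x y : SparseSet p k) : ℕ := (x.1 ∩ y.1).card

lemma card_swap {s : Finset (Fin p)} {e : Fin p × Fin p} (h : e.1 ∈ s ∧ e.2 ∉ s) :
    (insert e.2 (s.erase e.1)).card = s.card := by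
  rw [Finset.card_insert_of_notMem (fun h' => h.2 (Finset.mem_of_mem_erase h')),
    Finset.card_erase_add_one h.1]

/-- The vector obtained from `x` by removing the index `e.1` from the support and adding `e.2`. -/
def swap (x : SparseSet p k) (e : Fin p × Fin p) : SparseSet p k :=
  -- Pairs that are not legal swaps get the junk value `x`, so that sums over pairs of indices need
  -- no dependent types.
  if h : e.1 ∈ x.1 ∧ e.2 ∉ x.1 then ⟨insert e.2 (x.1.erase e.1), (card_swap h).trans x.2⟩ else x

lemma swap_val {x : SparseSet p k} {e : Fin p × Fin p} (h1 : e.1 ∈ x.1) (h2 : e.2 ∉ x.1) :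
    (swap x e).1 = insert e.2 (x.1.erase e.1) := by
  rw [swap, dif_pos ⟨h1, h2⟩]

lemma sdiff_swap {x : SparseSet p k} {e : Fin p × Fin p} (h1 : e.1 ∈ x.1) (h2 : e.2 ∉ x.1) :
    x.1 \ (swap x e).1 = {e.1} := by
  rw [swap_val h1 h2]
  ext a
  simp only [Finset.mem_sdiff, Finset.mem_insert, Finset.mem_erase, Finset.mem_singleton]
  constructor
  · rintro ⟨ha, hb⟩
    by_contra hc
    exact hb (Or.inr ⟨hc, ha⟩)
  · rintro rfl
    refine ⟨h1, ?_⟩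
    rintro (h | h)
    · exact h2 (h ▸ h1)
    · exact h.1 rfl

lemma swap_sdiff {x : SparseSet p k} {e : Fin p × Fin p} (h1 : e.1 ∈ x.1) (h2 : e.2 ∉ x.1) :
    (swap x e).1 \ x.1 = {e.2} := by
  rw [swap_val h1 h2]
  ext a
  simp only [Finset.mem_sdiff, Finset.mem_insert, Finset.mem_erase, Finset.mem_singleton]
  constructor
  · rintro ⟨ha | ha, hb⟩
    · exact ha
    · exact absurd ha.2 hb
  · rintro rfl
    exact ⟨Or.inl rfl, h2⟩

lemma adj_swap {x : SparseSet p k} {e : Fin p × Fin p} (h1 : e.1 ∈ x.1) (h2 : e.2 ∉ x.1) :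
    (johnsonGraph p k).Adj x (swap x e) := by
  change (symmDiff x.1 (swap x e).1).card = 2
  rw [symmDiff_def, Finset.sup_eq_union, sdiff_swap h1 h2, swap_sdiff h1 h2,
    Finset.card_union_of_disjoint, Finset.card_singleton, Finset.card_singleton]
  rw [Finset.disjoint_singleton]
  rintro h
  exact h2 (h ▸ h1)

lemma card_sdiff_add_overlap (x y : SparseSet p k) : (x.1 \ y.1).card + overlap x y = k := by
  rw [overlap, Finset.card_sdiff_add_card_inter, x.2]

lemma overlap_comm (x y : SparseSet p k) : overlap x y = overlap y x := by
  rw [overlap, overlap, Finset.inter_comm]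

lemma overlap_le (x y : SparseSet p k) : overlap x y ≤ k := by
  have := card_sdiff_add_overlap x y
  omega

lemma overlap_self (x : SparseSet p k) : overlap x x = k := by
  rw [overlap, Finset.inter_self, x.2]

lemma overlap_lt_of_ne {x v : SparseSet p k} (h : x ≠ v) : overlap x v < k := by
  refine (overlap_le x v).lt_of_ne fun heq => h ?_
  have h1 : x.1 ∩ v.1 = x.1 :=
    Finset.eq_of_subset_of_card_le Finset.inter_subset_left (by rw [x.2]; exact heq.ge)
  have h2 : x.1 ∩ v.1 = v.1 :=
    Finset.eq_of_subset_of_card_le Finset.inter_subset_right (by rw [v.2]; exact heq.ge)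
  exact Subtype.ext (h1.symm.trans h2)

lemma exists_swap_of_adj {x y : SparseSet p k} (h : (johnsonGraph p k).Adj x y) :
    ∃ e : Fin p × Fin p, e.1 ∈ x.1 ∧ e.2 ∉ x.1 ∧ swap x e = y := by
  change (symmDiff x.1 y.1).card = 2 at h
  rw [symmDiff_def, Finset.sup_eq_union,
    Finset.card_union_of_disjoint (disjoint_sdiff_sdiff)] at h
  have h1 := card_sdiff_add_overlap x y
  have h2 := card_sdiff_add_overlap y x
  rw [overlap_comm] at h2
  obtain ⟨i, hi⟩ := Finset.card_eq_one.1 (show (x.1 \ y.1).card = 1 by omega)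
  obtain ⟨j, hj⟩ := Finset.card_eq_one.1 (show (y.1 \ x.1).card = 1 by omega)
  have hi' : i ∈ x.1 \ y.1 := by simp [hi]
  have hj' : j ∈ y.1 \ x.1 := by simp [hj]
  rw [Finset.mem_sdiff] at hi' hj'
  refine ⟨(i, j), hi'.1, hj'.2, Subtype.ext ?_⟩
  rw [swap_val hi'.1 hj'.2]
  ext a
  simp only [Finset.mem_insert, Finset.mem_erase]
  constructor
  · rintro (rfl | ⟨ha, hx⟩)
    · exact hj'.1
    · by_contra hy
      have : a ∈ x.1 \ y.1 := Finset.mem_sdiff.2 ⟨hx, hy⟩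
      rw [hi, Finset.mem_singleton] at this
      exact ha this
  · intro hy
    by_cases hx : a ∈ x.1
    · refine Or.inr ⟨?_, hx⟩
      rintro rfl
      exact hi'.2 hy
    · have : a ∈ y.1 \ x.1 := Finset.mem_sdiff.2 ⟨hy, hx⟩
      rw [hj, Finset.mem_singleton] at this
      exact Or.inl this

/-- The removed and the added index are recovered from the two set differences of `x` and the new
state. -/
lemma swap_injOn (x : SparseSet p k) :
    Set.InjOn (swap x) (x.1 ×ˢ x.1ᶜ : Finset (Fin p × Fin p)) := by
  intro e he e' he' h
  simp only [Finset.coe_product, Set.mem_prod, Finset.mem_coe, Finset.mem_compl] at he he'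
  have h1 := sdiff_swap he.1 he.2
  rw [h, sdiff_swap he'.1 he'.2, Finset.singleton_inj] at h1
  have h2 := swap_sdiff he.1 he.2
  rw [h, swap_sdiff he'.1 he'.2, Finset.singleton_inj] at h2
  exact Prod.ext h1.symm h2.symm

open Classical in
lemma neighborFinset_eq_image (x : SparseSet p k) :
    (johnsonGraph p k).neighborFinset x = (x.1 ×ˢ x.1ᶜ).image (swap x) := by
  ext y
  simp only [SimpleGraph.mem_neighborFinset, Finset.mem_image, Finset.mem_product,
    Finset.mem_compl]
  constructor
  · intro h
    obtain ⟨e, h1, h2, h3⟩ := exists_swap_of_adj h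
    exact ⟨e, ⟨h1, h2⟩, h3⟩
  · rintro ⟨e, he, rfl⟩
    exact adj_swap he.1 he.2

open Classical in
lemma sum_neighborFinset (x : SparseSet p k) (g : SparseSet p k → ℝ) :
    ∑ y ∈ (johnsonGraph p k).neighborFinset x, g y = ∑ e ∈ x.1 ×ˢ x.1ᶜ, g (swap x e) := by
  rw [neighborFinset_eq_image, Finset.sum_image (swap_injOn x)]

open Classical in
lemma maxDegree_johnsonGraph_le : (johnsonGraph p k).maxDegree ≤ k * p := by
  refine SimpleGraph.maxDegree_le_of_forall_degree_le _ _ fun x => ?_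
  rw [← SimpleGraph.card_neighborFinset_eq_degree, neighborFinset_eq_image]
  refine Finset.card_image_le.trans ?_
  rw [Finset.card_product, x.2]
  exact Nat.mul_le_mul_left _ (by simpa using Finset.card_le_univ x.1ᶜ)

lemma overlap_swap (x v : SparseSet p k) {e : Fin p × Fin p} (h1 : e.1 ∈ x.1)
    (h2 : e.2 ∉ x.1) :
    overlap (swap x e) v + (if e.1 ∈ v.1 then 1 else 0) =
      overlap x v + (if e.2 ∈ v.1 then 1 else 0) := by
  have key : overlap (swap x e) v =
      ((x.1 ∩ v.1).erase e.1).card + (if e.2 ∈ v.1 then 1 else 0) := by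
    rw [overlap, swap_val h1 h2]
    split_ifs with h
    · rw [Finset.insert_inter_of_mem h, Finset.card_insert_of_notMem, Finset.erase_inter]
      intro h'
      exact h2 (Finset.mem_of_mem_erase (Finset.mem_of_mem_inter_left h'))
    · rw [Finset.insert_inter_of_notMem h, Finset.erase_inter, add_zero]
  have key2 : ((x.1 ∩ v.1).erase e.1).card + (if e.1 ∈ v.1 then 1 else 0) = overlap x v := by
    split_ifs with h
    · exact Finset.card_erase_add_one (Finset.mem_inter.2 ⟨h1, h⟩)
    · rw [Finset.erase_eq_of_notMem (fun h' => h (Finset.mem_of_mem_inter_right h')), add_zero]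
      rfl
  omega

/-- The moves from `x` that increase the overlap with `v`. -/
def upMoves (x v : SparseSet p k) : Finset (Fin p × Fin p) := (x.1 \ v.1) ×ˢ (v.1 \ x.1)

/-- The moves from `x` that decrease the overlap with `v`. -/
def downMoves (x v : SparseSet p k) : Finset (Fin p × Fin p) := (x.1 ∩ v.1) ×ˢ (x.1 ∪ v.1)ᶜ

lemma mem_upMoves {x v : SparseSet p k} {e : Fin p × Fin p} :
    e ∈ upMoves x v ↔ (e.1 ∈ x.1 ∧ e.1 ∉ v.1) ∧ e.2 ∈ v.1 ∧ e.2 ∉ x.1 := by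
  simp [upMoves]

lemma mem_downMoves {x v : SparseSet p k} {e : Fin p × Fin p} :
    e ∈ downMoves x v ↔ (e.1 ∈ x.1 ∧ e.1 ∈ v.1) ∧ e.2 ∉ x.1 ∧ e.2 ∉ v.1 := by
  simp [downMoves]

lemma overlap_swap_of_mem_upMoves {x v : SparseSet p k} {e : Fin p × Fin p}
    (he : e ∈ upMoves x v) : overlap (swap x e) v = overlap x v + 1 := by
  obtain ⟨h1, h2⟩ := mem_upMoves.1 he
  have := overlap_swap x v h1.1 h2.2
  rwa [if_neg h1.2, if_pos h2.1] at this

lemma card_upMoves (x v : SparseSet p k) :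
    ((upMoves x v).card : ℝ) = ((k : ℝ) - overlap x v) ^ 2 := by
  have h1 := card_sdiff_add_overlap x v
  have h2 := card_sdiff_add_overlap v x
  rw [overlap_comm] at h2
  have h3 : ((x.1 \ v.1).card : ℝ) + overlap x v = k := by exact_mod_cast h1
  have h4 : ((v.1 \ x.1).card : ℝ) + overlap x v = k := by exact_mod_cast h2
  rw [upMoves, Finset.card_product, Nat.cast_mul, ← h3, show ((v.1 \ x.1).card : ℝ) =
    (x.1 \ v.1).card by linarith]
  ring

lemma card_downMoves (x v : SparseSet p k) :
    ((downMoves x v).card : ℝ) = overlap x v * ((p : ℝ) - 2 * k + overlap x v) := by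
  have h1 := Finset.card_union_add_card_inter x.1 v.1
  rw [x.2, v.2] at h1
  have h2 := Finset.card_add_card_compl (x.1 ∪ v.1)
  rw [Fintype.card_fin] at h2
  have h3 : ((x.1 ∪ v.1).card : ℝ) + overlap x v = k + k := by exact_mod_cast h1
  have h4 : ((x.1 ∪ v.1).card : ℝ) + ((x.1 ∪ v.1)ᶜ).card = p := by exact_mod_cast h2
  rw [downMoves, Finset.card_product, Nat.cast_mul, show (((x.1 ∪ v.1)ᶜ).card : ℝ) =
    (p : ℝ) - 2 * k + overlap x v by linarith]
  rfl

/-- A sum over all moves from `x` of a function which vanishes on the moves that keep the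
overlap with `v`. -/
lemma sum_moves_eq (x v : SparseSet p k) (g : Fin p × Fin p → ℝ)
    (hg : ∀ e ∈ x.1 ×ˢ x.1ᶜ, overlap (swap x e) v = overlap x v → g e = 0) :
    ∑ e ∈ x.1 ×ˢ x.1ᶜ, g e = ∑ e ∈ upMoves x v, g e + ∑ e ∈ downMoves x v, g e := by
  rw [← Finset.sum_union]
  · symm
    refine Finset.sum_subset ?_ ?_
    · intro e he
      rw [Finset.mem_union, mem_upMoves, mem_downMoves] at he
      rw [Finset.mem_product, Finset.mem_compl]
      tauto
    · intro e he hne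
      refine hg e he ?_
      rw [Finset.mem_product, Finset.mem_compl] at he
      have := overlap_swap x v he.1 he.2
      rw [Finset.mem_union, mem_upMoves, mem_downMoves] at hne
      split_ifs at this <;> first | omega | (exfalso; tauto)
  · rw [Finset.disjoint_left]
    intro e h1 h2
    rw [mem_upMoves] at h1
    rw [mem_downMoves] at h2
    exact h1.1.2 h2.1.2

lemma overlap_swap_of_mem_downMoves {x v : SparseSet p k} {e : Fin p × Fin p}
    (he : e ∈ downMoves x v) : overlap (swap x e) v + 1 = overlap x v := by
  obtain ⟨h1, h2⟩ := mem_downMoves.1 he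
  have := overlap_swap x v h1.1 h2.1
  rwa [if_pos h1.2, if_neg h2.2] at this

/-! ### Concentration and persistence of the overlap -/

open Classical in
-- The summand is antisymmetric in the two ends of an edge. In other words, the uniform law is
-- stationary for the walk on the Johnson graph.
lemma sum_sum_moves_sub (h : SparseSet p k → ℝ) :
    ∑ x : SparseSet p k, ∑ e ∈ x.1 ×ˢ x.1ᶜ, (h (swap x e) - h x) = 0 := by
  have h1 : ∀ x : SparseSet p k, ∑ e ∈ x.1 ×ˢ x.1ᶜ, (h (swap x e) - h x) =
      ∑ y, if (johnsonGraph p k).Adj x y then h y - h x else 0 := by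
    intro x
    rw [← sum_neighborFinset x (fun y => h y - h x), SimpleGraph.neighborFinset_eq_filter,
      Finset.sum_filter]
  simp only [h1]
  have h2 : ∑ x, ∑ y, (if (johnsonGraph p k).Adj x y then h y - h x else 0) =
      - ∑ x, ∑ y, (if (johnsonGraph p k).Adj x y then h y - h x else 0) := by
    conv_lhs => rw [Finset.sum_comm]
    rw [← Finset.sum_neg_distrib]
    refine Finset.sum_congr rfl fun x _ => ?_
    rw [← Finset.sum_neg_distrib]
    refine Finset.sum_congr rfl fun y _ => ?_
    rw [SimpleGraph.adj_comm]
    split_ifs <;> ring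
  linarith

/-- Under that walk the overlap is a birth-death process; this is its generator, not normalized by
the degree. -/
lemma sum_moves_overlap (x v : SparseSet p k) (g : ℝ → ℝ) :
    ∑ e ∈ x.1 ×ˢ x.1ᶜ, (g (overlap (swap x e) v) - g (overlap x v)) =
      ((k : ℝ) - overlap x v) ^ 2 * (g (overlap x v + 1) - g (overlap x v)) +
      overlap x v * ((p : ℝ) - 2 * k + overlap x v) *
        (g (overlap x v - 1) - g (overlap x v)) := by
  rw [sum_moves_eq x v]
  · congr 1
    · rw [← card_upMoves, ← nsmul_eq_mul]
      refine Finset.sum_eq_card_nsmul fun e he => ?_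
      rw [overlap_swap_of_mem_upMoves he]
      push_cast
      rfl
    · rw [← card_downMoves, ← nsmul_eq_mul]
      refine Finset.sum_eq_card_nsmul fun e he => ?_
      have : (overlap (swap x e) v : ℝ) = overlap x v - 1 := by
        rw [← overlap_swap_of_mem_downMoves he]; push_cast; ring
      rw [this]
  · intro e _ h
    rw [h, sub_self]

/-- The overlap of a uniformly random sparse vector with `v` has variance at most its mean. -/
lemma sum_overlap_sub_sq_le (hp : 0 < p) (v : SparseSet p k) :
    ∑ x : SparseSet p k, ((overlap x v : ℝ) - (k : ℝ) ^ 2 / p) ^ 2 ≤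
      Fintype.card (SparseSet p k) * ((k : ℝ) ^ 2 / p) := by
  have hp' : (0 : ℝ) < p := by exact_mod_cast hp
  set ℓ : ℝ := (k : ℝ) ^ 2 / p with hℓ
  have hk : (k : ℝ) ^ 2 = p * ℓ := by rw [hℓ]; field_simp
  -- Stationarity is applied to the squared deviation and to the overlap itself. Upward minus
  -- downward moves number `-p * (overlap - ℓ)`, so the two identities add up to `∑ p * (overlap -
  -- ℓ) ^ 2 = ∑ (k - overlap) ^ 2`, and the right side is bounded termwise by `k ^ 2`.
  have h1 := sum_sum_moves_sub (fun x : SparseSet p k => ((overlap x v : ℝ) - ℓ) ^ 2)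
  have h2 := sum_sum_moves_sub (fun x : SparseSet p k => (overlap x v : ℝ))
  simp only [sum_moves_overlap _ v (fun z => (z - ℓ) ^ 2)] at h1
  simp only [sum_moves_overlap _ v (fun z => z)] at h2
  have h3 : ∑ x : SparseSet p k, 2 * p * ((overlap x v : ℝ) - ℓ) ^ 2 ≤
      ∑ _x : SparseSet p k, 2 * (k : ℝ) ^ 2 := by
    rw [← sub_nonneg, ← Finset.sum_sub_distrib]
    have h4 : (0 : ℝ) ≤ ∑ x : SparseSet p k, 2 * ((k : ℝ) ^ 2 - ((k : ℝ) - overlap x v) ^ 2) := by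
      refine Finset.sum_nonneg fun x _ => ?_
      have h5 : (overlap x v : ℝ) ≤ k := by exact_mod_cast overlap_le x v
      have h6 : (0 : ℝ) ≤ overlap x v := by positivity
      nlinarith
    have h8 := add_nonneg h4 (add_nonneg h1.ge h2.ge)
    rw [← Finset.sum_add_distrib, ← Finset.sum_add_distrib] at h8
    refine h8.trans_eq (Finset.sum_congr rfl fun x _ => ?_)
    linear_combination (2 * (overlap x v : ℝ) - 2 * ℓ) * hk
  rw [← Finset.mul_sum, Finset.sum_const, nsmul_eq_mul, Finset.card_univ, hk] at h3
  nlinarith [hp']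

/-- Chebyshev: the variance is at most the mean `k ^ 2 / p`, and the deviation is a quarter of the
mean. -/
lemma sum_uniformInit_low_overlap_le (hp : 0 < p) (hk : 0 < k) (v : SparseSet p k) :
    ∑ x ∈ Finset.univ.filter (fun x : SparseSet p k =>
      (overlap x v : ℝ) < 3 / 4 * ((k : ℝ) ^ 2 / p)), uniformInit (SparseSet p k) x ≤
      16 / ((k : ℝ) ^ 2 / p) := by
  have hp' : (0 : ℝ) < p := by exact_mod_cast hp
  have hk' : (0 : ℝ) < k := by exact_mod_cast hk
  set ℓ : ℝ := (k : ℝ) ^ 2 / p with hℓ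
  have hℓ0 : 0 < ℓ := by positivity
  have : Nonempty (SparseSet p k) := ⟨v⟩
  have hn : (0 : ℝ) < Fintype.card (SparseSet p k) := by exact_mod_cast Fintype.card_pos
  have h1 := sum_overlap_sub_sq_le hp v
  rw [← hℓ] at h1
  rw [le_div_iff₀ hℓ0]
  simp only [uniformInit, Finset.sum_const, nsmul_eq_mul]
  set A := Finset.univ.filter (fun x : SparseSet p k => (overlap x v : ℝ) < 3 / 4 * ℓ)
  have h2 : (A.card : ℝ) * (ℓ ^ 2 / 16) ≤ Fintype.card (SparseSet p k) * ℓ := by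
    refine le_trans ?_ h1
    rw [← nsmul_eq_mul, ← Finset.sum_const]
    refine (Finset.sum_le_sum fun x hx => ?_).trans
      (Finset.sum_le_univ_sum_of_nonneg fun x => sq_nonneg _)
    have := (Finset.mem_filter.1 hx).2
    nlinarith
  rw [mul_one_div, div_mul_eq_mul_div, div_le_iff₀ hn]
  nlinarith

open Classical in
/-- Weighted by a decreasing exponential in the overlap, a proposal chain on the Johnson graph
that accepts most moves towards `v` does not leave the region of large overlap. -/
theorem sum_chainLaw_low_overlap_le (hp : 0 < p) (hk : 0 < k) (v : SparseSet p k)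
    {a : SparseSet p k → SparseSet p k → ℝ} (ha0 : ∀ x y, 0 ≤ a x y) (ha1 : ∀ x y, a x y ≤ 1)
    (hacc : ∀ x : SparseSet p k, (k : ℝ) ^ 2 / p / 2 ≤ overlap x v + 1 / 2 →
      (overlap x v : ℝ) < 3 / 4 * ((k : ℝ) ^ 2 / p) →
      7 / 8 * ((k : ℝ) - overlap x v) ^ 2 ≤
        ((upMoves x v).filter fun e => a x (swap x e) = 1).card) (n : ℕ) :
    ∑ x ∈ (Finset.univ.filter fun x : SparseSet p k =>
        (k : ℝ) ^ 2 / p / 2 ≤ overlap x v + 1 / 2)ᶜ,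
      chainLaw (uniformInit _) (proposalChain (johnsonGraph p k) a) n x ≤
      16 / ((k : ℝ) ^ 2 / p) + (n + 1) * (6 / 7 : ℝ) ^ ((k : ℝ) ^ 2 / p / 4 - 1 / 2) := by
  have hp' : (0 : ℝ) < p := by exact_mod_cast hp
  have hk' : (0 : ℝ) < k := by exact_mod_cast hk
  set ℓ : ℝ := (k : ℝ) ^ 2 / p with hℓ
  have hkℓ : (k : ℝ) ^ 2 = p * ℓ := by rw [hℓ]; field_simp
  have hℓ0 : 0 < ℓ := by positivity
  have : Nonempty (SparseSet p k) := ⟨v⟩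
  set P := proposalChain (johnsonGraph p k) a with hPdef
  have hP : IsStochastic P := proposalChain_isStochastic _ ha0 ha1
  -- The base `6/7` is chosen so that an upward move lowers `g` by `g / 7` and a downward move
  -- raises it by `g / 6`. With at least `7/8` of the upward moves accepted and at most `3/4` as
  -- many downward moves as upward ones, the two effects balance at `1/8` each.
  let g : ℝ → ℝ := fun z => (6 / 7 : ℝ) ^ (z + 1 / 2 - ℓ / 2)
  have hg0 : ∀ z, 0 < g z := fun z => Real.rpow_pos_of_pos (by norm_num) _
  have hganti : ∀ z w, z ≤ w → g w ≤ g z := fun z w h =>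
    Real.rpow_le_rpow_of_exponent_ge (by norm_num) (by norm_num) (by linarith)
  have hgsucc : ∀ z, g (z + 1) = 6 / 7 * g z := by
    intro z
    simp only [g]
    rw [show z + 1 + 1 / 2 - ℓ / 2 = z + 1 / 2 - ℓ / 2 + 1 by ring,
      Real.rpow_add_one (by norm_num)]
    ring
  have hgpred : ∀ z, g (z - 1) = 7 / 6 * g z := by
    intro z
    have := hgsucc (z - 1)
    rw [sub_add_cancel] at this
    linarith
  -- Truncation at `1` makes the drift nonpositive outside the good region, where `φ = 1`, so
  -- nothing is needed about the moves there.
  let φ : SparseSet p k → ℝ := fun x => min 1 (g (overlap x v))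
  have hφ0 : ∀ x, 0 ≤ φ x := fun x => le_min zero_le_one (hg0 _).le
  set E : ℝ := (6 / 7 : ℝ) ^ (ℓ / 4 - 1 / 2) with hE
  have hE0 : 0 < E := Real.rpow_pos_of_pos (by norm_num) _
  have hmove : ∀ (x : SparseSet p k) (e : Fin p × Fin p), e ∈ x.1 ×ˢ x.1ᶜ →
      (overlap x v : ℝ) - 1 ≤ overlap (swap x e) v := by
    intro x e he
    rw [Finset.mem_product, Finset.mem_compl] at he
    have h1 := overlap_swap x v he.1 he.2
    have h2 : overlap x v ≤ overlap (swap x e) v + 1 := by split_ifs at h1 <;> omega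
    have h3 : (overlap x v : ℝ) ≤ overlap (swap x e) v + 1 := by exact_mod_cast h2
    linarith
  have hdrift : ∀ x, ∑ y, P x y * φ y ≤ φ x + E := by
    intro x
    by_cases hx1 : ℓ / 2 ≤ overlap x v + 1 / 2
    swap
    · have h1 : φ x = 1 := by
        refine min_eq_left ?_
        refine Real.one_le_rpow_of_pos_of_le_one_of_nonpos (by norm_num) (by norm_num) ?_
        linarith [not_le.1 hx1]
      calc ∑ y, P x y * φ y ≤ ∑ y, P x y * 1 :=
            Finset.sum_le_sum fun y _ =>
              mul_le_mul_of_nonneg_left (min_le_left _ _) (hP.nonneg x y)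
        _ = 1 := by simp [hP.sum_eq_one]
        _ ≤ φ x + E := by linarith
    have hφx : φ x = g (overlap x v) := by
      refine min_eq_right ?_
      exact Real.rpow_le_one (by norm_num) (by norm_num) (by linarith)
    rw [hPdef, sum_proposalChain_mul _ ha0 ha1]
    by_cases hx2 : (overlap x v : ℝ) < 3 / 4 * ℓ
    · have hup := hacc x hx1 hx2
      suffices h : ∑ y ∈ (johnsonGraph p k).neighborFinset x, a x y * (φ y - φ x) ≤ 0 by
        have := mul_nonpos_of_nonneg_of_nonpos
          (show (0 : ℝ) ≤ 1 / ((johnsonGraph p k).maxDegree : ℝ) by positivity) h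
        linarith
      rw [sum_neighborFinset x (fun y => a x y * (φ y - φ x))]
      have hle : ∀ e, a x (swap x e) * (φ (swap x e) - φ x) ≤
          a x (swap x e) * (g (overlap (swap x e) v) - g (overlap x v)) := by
        intro e
        refine mul_le_mul_of_nonneg_left ?_ (ha0 _ _)
        rw [hφx]
        exact sub_le_sub_right (min_le_right _ _) _
      refine (Finset.sum_le_sum fun e _ => hle e).trans ?_
      rw [sum_moves_eq x v]
      swap
      · intro e _ he
        rw [he, sub_self, mul_zero]
      have h1 : ∑ e ∈ upMoves x v,
          a x (swap x e) * (g (overlap (swap x e) v) - g (overlap x v)) ≤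
          -(7 / 8 * ((k : ℝ) - overlap x v) ^ 2 * (g (overlap x v) / 7)) := by
        calc ∑ e ∈ upMoves x v,
              a x (swap x e) * (g (overlap (swap x e) v) - g (overlap x v))
            ≤ ∑ e ∈ upMoves x v, if a x (swap x e) = 1 then -(g (overlap x v) / 7) else 0 := by
              refine Finset.sum_le_sum fun e he => ?_
              have h2 : g (overlap (swap x e) v) - g (overlap x v) = -(g (overlap x v) / 7) := by
                rw [overlap_swap_of_mem_upMoves he, Nat.cast_add, Nat.cast_one, hgsucc]
                ring
              rw [h2]
              split_ifs with h3
              · rw [h3, one_mul]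
              · have := mul_nonneg (ha0 x (swap x e)) (div_pos (hg0 (overlap x v))
                  (by norm_num : (0 : ℝ) < 7)).le
                linarith
          _ = -(((upMoves x v).filter fun e => a x (swap x e) = 1).card *
                (g (overlap x v) / 7)) := by
              rw [← Finset.sum_filter, Finset.sum_const, nsmul_eq_mul]
              ring
          _ ≤ _ := by
              have := hg0 (overlap x v)
              exact neg_le_neg (mul_le_mul_of_nonneg_right hup (by positivity))
      have h2 : ∑ e ∈ downMoves x v,
          a x (swap x e) * (g (overlap (swap x e) v) - g (overlap x v)) ≤
          overlap x v * ((p : ℝ) - 2 * k + overlap x v) * (g (overlap x v) / 6) := by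
        rw [← card_downMoves, ← nsmul_eq_mul]
        refine Finset.sum_le_card_nsmul _ _ _ fun e he => ?_
        have h3 : (overlap (swap x e) v : ℝ) = overlap x v - 1 := by
          rw [← overlap_swap_of_mem_downMoves he]; push_cast; ring
        rw [h3, hgpred]
        have := mul_le_mul_of_nonneg_right (ha1 x (swap x e)) (hg0 (overlap x v)).le
        linarith
      -- Downward moves are fewer than upward ones by `p * (ℓ - overlap) ≥ p * ℓ / 4 = k ^ 2 / 4`,
      -- at least a quarter of the upward ones.
      have h3 : (overlap x v : ℝ) * ((p : ℝ) - 2 * k + overlap x v) ≤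
          3 / 4 * ((k : ℝ) - overlap x v) ^ 2 := by
        have h5 : (overlap x v : ℝ) ≤ k := by exact_mod_cast overlap_le x v
        have h6 : (0 : ℝ) ≤ overlap x v := by positivity
        have h7 : ((k : ℝ) - overlap x v) ^ 2 ≤ p * ℓ := by rw [← hkℓ]; nlinarith
        have h8 : (p : ℝ) * overlap x v ≤ p * (3 / 4 * ℓ) :=
          mul_le_mul_of_nonneg_left hx2.le hp'.le
        have h9 : (overlap x v : ℝ) * ((p : ℝ) - 2 * k + overlap x v) =
          ((k : ℝ) - overlap x v) ^ 2 - p * ℓ + p * overlap x v := by rw [← hkℓ]; ring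
        rw [h9]
        linarith
      have h4 := mul_le_mul_of_nonneg_right h3 (hg0 (overlap x v)).le
      linarith
    -- Above overlap `3ℓ/4` there is no drift to use, but one step lowers the overlap by at most
    -- one, so `φ` remains below `E`.
    · have hbd : ∀ e ∈ x.1 ×ˢ x.1ᶜ, a x (swap x e) * (φ (swap x e) - φ x) ≤ E := by
        intro e he
        have h1 : φ (swap x e) ≤ E := by
          refine (min_le_right _ _).trans ((hganti _ _ (hmove x e he)).trans ?_)
          exact Real.rpow_le_rpow_of_exponent_ge (by norm_num) (by norm_num)
            (by linarith [not_lt.1 hx2])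
        have h2 : φ (swap x e) - φ x ≤ E := by linarith [hφ0 x]
        exact (mul_le_mul_of_nonneg_left h2 (ha0 _ _)).trans
          (mul_le_of_le_one_left hE0.le (ha1 _ _))
      have hsum : ∑ y ∈ (johnsonGraph p k).neighborFinset x, a x y * (φ y - φ x) ≤
          (johnsonGraph p k).maxDegree * E := by
        have hb : ∀ y ∈ (johnsonGraph p k).neighborFinset x, a x y * (φ y - φ x) ≤ E := by
          intro y hy
          rw [neighborFinset_eq_image, Finset.mem_image] at hy
          obtain ⟨e, he, rfl⟩ := hy
          exact hbd e he
        refine (Finset.sum_le_card_nsmul _ _ _ hb).trans ?_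
        rw [nsmul_eq_mul, SimpleGraph.card_neighborFinset_eq_degree]
        exact mul_le_mul_of_nonneg_right
          (Nat.cast_le.2 ((johnsonGraph p k).degree_le_maxDegree x)) hE0.le
      have := mul_le_mul_of_nonneg_left hsum
        (show (0 : ℝ) ≤ 1 / ((johnsonGraph p k).maxDegree : ℝ) by positivity)
      have h3 : 1 / ((johnsonGraph p k).maxDegree : ℝ) *
          ((johnsonGraph p k).maxDegree * E) ≤ E := by
        rw [← mul_assoc, one_div]
        exact mul_le_of_le_one_left hE0.le (inv_mul_le_one_of_le₀ le_rfl (by positivity))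
      linarith
  have hinit : ∑ x, uniformInit (SparseSet p k) x * φ x ≤ 16 / ℓ + E := by
    calc ∑ x, uniformInit (SparseSet p k) x * φ x
        ≤ ∑ x, ((if (overlap x v : ℝ) < 3 / 4 * ℓ then uniformInit (SparseSet p k) x else 0) +
            uniformInit (SparseSet p k) x * E) := by
          refine Finset.sum_le_sum fun x _ => ?_
          have h0 := uniformInit_nonneg x
          split_ifs with h
          · have h1 := mul_le_of_le_one_right h0 (min_le_left 1 (g (overlap x v)))
            have h2 := mul_nonneg h0 hE0.le
            linarith
          · rw [zero_add]
            refine mul_le_mul_of_nonneg_left ((min_le_right _ _).trans ?_) h0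
            exact Real.rpow_le_rpow_of_exponent_ge (by norm_num) (by norm_num)
              (by linarith [not_lt.1 h])
      _ ≤ 16 / ℓ + E := by
          rw [Finset.sum_add_distrib, ← Finset.sum_filter, ← Finset.sum_mul, sum_uniformInit,
            one_mul]
          exact add_le_add_left (sum_uniformInit_low_overlap_le hp hk v) _
  have hfin := sum_chainLaw_mul_le uniformInit_nonneg sum_uniformInit hP hdrift n
  calc ∑ x ∈ (Finset.univ.filter fun x : SparseSet p k => ℓ / 2 ≤ overlap x v + 1 / 2)ᶜ,
        chainLaw (uniformInit _) P n x
      ≤ ∑ x ∈ (Finset.univ.filter fun x : SparseSet p k => ℓ / 2 ≤ overlap x v + 1 / 2)ᶜ,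
        chainLaw (uniformInit _) P n x * φ x := by
        refine Finset.sum_le_sum fun x hx => ?_
        rw [Finset.mem_compl, Finset.mem_filter, not_and] at hx
        have h1 : φ x = 1 := by
          refine min_eq_left ?_
          refine Real.one_le_rpow_of_pos_of_le_one_of_nonpos (by norm_num) (by norm_num) ?_
          linarith [not_le.1 (hx (Finset.mem_univ x))]
        rw [h1, mul_one]
    _ ≤ ∑ x, chainLaw (uniformInit _) P n x * φ x :=
        Finset.sum_le_univ_sum_of_nonneg fun x =>
          mul_nonneg (chainLaw_nonneg uniformInit_nonneg hP n x) (hφ0 x)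
    _ ≤ _ := by linarith

end Johnson

/-! ### The link function -/

section Link

variable {f : ℝ → ℝ} {ε t c M : ℝ}

namespace LinkAssumption

lemma differentiableOn (h : LinkAssumption f ε t c M) : DifferentiableOn ℝ f (Set.Icc 0 1) :=
  h.contDiffOn.differentiableOn (by norm_num)

lemma monotoneOn_deriv (h : LinkAssumption f ε t c M) :
    MonotoneOn (derivWithin f (Set.Icc 0 1)) (Set.Icc 0 1) :=
  h.convexOn.monotoneOn_derivWithin h.differentiableOn

lemma deriv_mul_le_sub (h : LinkAssumption f ε t c M) {x y : ℝ} (hx : 0 ≤ x) (hxy : x ≤ y)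
    (hy : y ≤ 1) : derivWithin f (Set.Icc 0 1) x * (y - x) ≤ f y - f x := by
  rcases hxy.eq_or_lt with rfl | hlt
  · simp
  · have h1 := h.convexOn.derivWithin_le_slope ⟨hx, hxy.trans hy⟩ ⟨hx.trans hxy, hy⟩ hlt
      (h.differentiableOn x ⟨hx, hxy.trans hy⟩)
    rwa [slope_def_field, le_div_iff₀ (sub_pos.2 hlt)] at h1

lemma sub_le_deriv_mul (h : LinkAssumption f ε t c M) {x y : ℝ} (hx : 0 ≤ x) (hxy : x ≤ y)
    (hy : y ≤ 1) : f y - f x ≤ derivWithin f (Set.Icc 0 1) y * (y - x) := by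
  rcases hxy.eq_or_lt with rfl | hlt
  · simp
  · have h1 := h.convexOn.slope_le_derivWithin ⟨hx, hxy.trans hy⟩ ⟨hx.trans hxy, hy⟩ hlt
      (h.differentiableOn y ⟨hx.trans hxy, hy⟩)
    rwa [slope_def_field, div_le_iff₀ (sub_pos.2 hlt)] at h1

/-- The lower bound on `f'` is assumed only on `[0, ε]`. Evaluating it at `ε * x` and using that
`f'` is monotone extends it to `[0, 1]`. -/
lemma rpow_le_deriv (h : LinkAssumption f ε t c M) (hε₀ : 0 < ε) (hε₁ : ε < 1) {x : ℝ}
    (hx : x ∈ Set.Icc (0 : ℝ) 1) : c * (ε * x) ^ (t - 1) ≤ derivWithin f (Set.Icc 0 1) x := by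
  have h1 : ε * x ∈ Set.Icc 0 ε :=
    ⟨mul_nonneg hε₀.le hx.1, mul_le_of_le_one_right hε₀.le hx.2⟩
  refine (h.le_deriv _ h1).trans (h.monotoneOn_deriv ⟨h1.1, h1.2.trans hε₁.le⟩ hx ?_)
  exact mul_le_of_le_one_left hx.1 hε₁.le

lemma bound_pos (h : LinkAssumption f ε t c M) (hε₀ : 0 < ε) (hε₁ : ε < 1) (hc : 0 < c) :
    0 < M := by
  have h1 := h.rpow_le_deriv hε₀ hε₁ (x := 1) ⟨zero_le_one, le_rfl⟩
  have h2 : 0 < c * (ε * 1) ^ (t - 1) := mul_pos hc (Real.rpow_pos_of_pos (by simpa) _)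
  linarith [h.deriv_one_le]

lemma sub_le_mul (h : LinkAssumption f ε t c M) {s : ℝ} (hs0 : 0 ≤ s) (hs1 : s ≤ 1) :
    f 1 - f (1 - s) ≤ M * s := by
  have h1 := h.sub_le_deriv_mul (x := 1 - s) (y := 1) (by linarith) (by linarith) le_rfl
  rw [sub_sub_cancel] at h1
  exact h1.trans (mul_le_mul_of_nonneg_right h.deriv_one_le hs0)

/-- The second difference of the link function at `1`. -/
lemma second_diff_le (h : LinkAssumption f ε t c M) (hε₀ : 0 < ε) (hε₁ : ε < 1) (hM : 0 < M)
    {s : ℝ} (hs0 : 0 ≤ s) (hs1 : 2 * s ≤ 1) :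
    f 1 - 2 * f (1 - s) + f (1 - 2 * s) ≤ 2 * M / ε * s ^ 2 := by
  by_cases hs : 2 * s ≤ ε
  · have h1 := h.sub_le_deriv_mul (x := 1 - s) (y := 1) (by linarith) (by linarith) le_rfl
    have h2 := h.deriv_mul_le_sub (x := 1 - 2 * s) (y := 1 - s) (by linarith) (by linarith)
      (by linarith)
    have hC1 : ContDiffOn ℝ 1 (derivWithin f (Set.Icc 0 1)) (Set.Icc 0 1) :=
      h.contDiffOn.derivWithin (uniqueDiffOn_Icc zero_lt_one) (by norm_num)
    have hsub : Set.Icc (1 - ε) 1 ⊆ Set.Icc (0 : ℝ) 1 := Set.Icc_subset_Icc (by linarith) le_rfl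
    have h3 : derivWithin f (Set.Icc 0 1) 1 - derivWithin f (Set.Icc 0 1) (1 - 2 * s) ≤
        M * (1 - (1 - 2 * s)) := by
      refine (convex_Icc (1 - ε) 1).image_sub_le_mul_sub_of_deriv_le
        (hC1.continuousOn.mono hsub) ?_ ?_ (1 - 2 * s) ⟨by linarith, by linarith⟩ 1
        ⟨by linarith, le_rfl⟩ (by linarith)
      · exact (hC1.differentiableOn (by norm_num)).mono (interior_subset.trans hsub)
      · intro x hx
        rw [interior_Icc] at hx
        have hx' : Set.Icc (0 : ℝ) 1 ∈ 𝓝 x := Icc_mem_nhds (by linarith [hx.1]) hx.2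
        have h4 := h.deriv_two_le x ⟨hx.1.le, hx.2.le⟩
        rw [iteratedDerivWithin_succ, iteratedDerivWithin_one] at h4
        rwa [derivWithin_of_mem_nhds hx'] at h4
    have h5 := mul_le_mul_of_nonneg_right h3 hs0
    have h6 : 2 * M * s ^ 2 ≤ 2 * M / ε * s ^ 2 := by
      refine mul_le_mul_of_nonneg_right ?_ (sq_nonneg s)
      rw [le_div_iff₀ hε₀]
      exact mul_le_of_le_one_right (by positivity) hε₁.le
    nlinarith
  -- Here `s > ε / 2`, so the first-order bound `M * s` is already below the quadratic one.
  · have h1 := h.sub_le_mul hs0 (by linarith)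
    have h2 : f (1 - 2 * s) ≤ f (1 - s) :=
      h.monotoneOn ⟨by linarith, by linarith⟩ ⟨by linarith, by linarith⟩ (by linarith)
    have h3 : M * s ≤ 2 * M / ε * s ^ 2 := by
      rw [div_mul_eq_mul_div, le_div_iff₀ hε₀]
      nlinarith [mul_pos hM (show 0 < s by linarith)]
    linarith

/-- The gain of the link function when the overlap `o` increases by one. -/
lemma increment_ge (h : LinkAssumption f ε t c M) (hε₀ : 0 < ε) (hε₁ : ε < 1)
    {o k : ℝ} (hk : 0 < k) (ho : 0 ≤ o) (hok : o + 1 ≤ k) :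
    c / (2 * k) * (ε * ((o + 1 / 2) / k)) ^ (t - 1) ≤ f ((o + 1) / k) - f (o / k) := by
  have h1 : (o + 1) / k ≤ 1 := div_le_one_of_le₀ hok hk.le
  -- Only the second half of the step is used: the derivative at its left end is bounded away from
  -- zero even when `o = 0`.
  have h2 : (o + 1 / 2) / k ≤ (o + 1) / k := by gcongr; norm_num
  have h3 : o / k ≤ (o + 1 / 2) / k := by gcongr; norm_num
  have h4 : 0 ≤ o / k := by positivity
  have h5 := h.deriv_mul_le_sub (h4.trans h3) h2 h1
  have h6 := h.monotoneOn ⟨h4, h3.trans (h2.trans h1)⟩ ⟨h4.trans h3, h2.trans h1⟩ h3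
  have h7 := h.rpow_le_deriv hε₀ hε₁ ⟨h4.trans h3, h2.trans h1⟩
  have h8 : (o + 1) / k - (o + 1 / 2) / k = 1 / (2 * k) := by field_simp; ring
  rw [h8] at h5
  have h9 := mul_le_mul_of_nonneg_right h7 (show 0 ≤ 1 / (2 * k) by positivity)
  have h10 : c / (2 * k) * (ε * ((o + 1 / 2) / k)) ^ (t - 1) =
      c * (ε * ((o + 1 / 2) / k)) ^ (t - 1) * (1 / (2 * k)) := by ring
  linarith

end LinkAssumption

end Link

/-! ### Gaussian tails -/

section Gaussian

variable {E : Type*} [NormedAddCommGroup E] [InnerProductSpace ℝ E] [FiniteDimensional ℝ E]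
  [MeasurableSpace E] [BorelSpace E]

lemma stdGaussian_map_inner (u : E) :
    (stdGaussian E).map (fun w => inner ℝ u w) = gaussianReal 0 (‖u‖ ^ 2).toNNReal := by
  have h := IsGaussian.map_eq_gaussianReal (μ := stdGaussian E) (innerSL ℝ u)
  rw [integral_strongDual_stdGaussian, variance_dual_stdGaussian, innerSL_apply_norm] at h
  exact h

/-- Chernoff bound for a linear functional of a standard Gaussian vector. -/
lemma stdGaussian_real_le_inner (u : E) {s θ b : ℝ} (hs : ‖u‖ ^ 2 ≤ s) (hθ : 0 ≤ θ) :
    (stdGaussian E).real {w | b ≤ inner ℝ u w} ≤ Real.exp (-(θ * b) + θ ^ 2 * s / 2) := by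
  have hmap := stdGaussian_map_inner u
  have hint : Integrable (fun w => Real.exp (θ * inner ℝ u w)) (stdGaussian E) := by
    have h1 : Integrable (fun y => Real.exp (θ * y)) (gaussianReal 0 (‖u‖ ^ 2).toNNReal) :=
      integrable_exp_mul_gaussianReal θ
    rw [← hmap] at h1
    exact h1.comp_measurable (by fun_prop)
  refine (measure_ge_le_exp_mul_mgf b hθ hint).trans ?_
  rw [mgf_gaussianReal hmap, ← Real.exp_add]
  refine Real.exp_le_exp.2 ?_
  rw [Real.coe_toNNReal _ (sq_nonneg _)]
  nlinarith [mul_le_mul_of_nonneg_left hs (sq_nonneg θ)]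

end Gaussian

/-! ### The noise in the Hamiltonian -/

section Noise

variable {p k d : ℕ} {f : ℝ → ℝ}
  {F : EuclideanSpace ℝ (Fin p) → EuclideanSpace ℝ (Fin d)}

lemma inner_normalizedVec (x y : SparseSet p k) :
    inner ℝ (normalizedVec x) (normalizedVec y) = (overlap x y : ℝ) / k := by
  simp only [normalizedVec, inner_smul_left, inner_smul_right, PiLp.inner_apply,
    overlap, RCLike.inner_apply, conj_trivial, ite_mul, one_mul, zero_mul]
  rw [← mul_assoc, ← sq, div_pow, Real.sq_sqrt (by positivity)]
  have : ∑ i, (if i ∈ y.1 then if i ∈ x.1 then (1 : ℝ) else 0 else 0) = (x.1 ∩ y.1).card := by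
    simp only [← ite_and]
    rw [Finset.sum_boole]
    congr 2
    ext i
    simp [and_comm]
  rw [this]
  ring

lemma norm_normalizedVec (hk : 0 < k) (x : SparseSet p k) : ‖normalizedVec x‖ = 1 := by
  have h := inner_normalizedVec x x
  rw [overlap_self, div_self (by positivity), real_inner_self_eq_norm_sq] at h
  exact (pow_eq_one_iff_of_nonneg (norm_nonneg _) two_ne_zero).1 h

lemma inner_feature (hF : IsFeatureMap f F) (hk : 0 < k) (x y : SparseSet p k) :
    inner ℝ (F (normalizedVec x)) (F (normalizedVec y)) = f ((overlap x y : ℝ) / k) := by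
  rw [hF _ _ (norm_normalizedVec hk x) (norm_normalizedVec hk y), inner_normalizedVec]

/-- The noise part of the Hamiltonian. -/
def noise (F : EuclideanSpace ℝ (Fin p) → EuclideanSpace ℝ (Fin d))
    (W : EuclideanSpace ℝ (Fin d)) (x : SparseSet p k) : ℝ :=
  inner ℝ (F (normalizedVec x)) W

lemma hamiltonian_eq (hF : IsFeatureMap f F) (hk : 0 < k) (lam : ℝ) (v x : SparseSet p k)
    (W : EuclideanSpace ℝ (Fin d)) :
    hamiltonian F (observation F lam v W) x =
      lam * f ((overlap x v : ℝ) / k) + noise F W x := by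
  rw [hamiltonian, observation, inner_add_right, inner_smul_right, inner_feature hF hk]
  rfl

/-! ### Noise increments along a matching -/

/-- No two moves in `S` remove the same index or add the same index. -/
def IsMatching (S : Finset (Fin p × Fin p)) : Prop :=
  ∀ e ∈ S, ∀ e' ∈ S, e ≠ e' → e.1 ≠ e'.1 ∧ e.2 ≠ e'.2

lemma overlap_swap_self {x : SparseSet p k} {e : Fin p × Fin p} (h1 : e.1 ∈ x.1)
    (h2 : e.2 ∉ x.1) : overlap (swap x e) x + 1 = k := by
  have := overlap_swap x x h1 h2
  rwa [if_pos h1, if_neg h2, add_zero, overlap_self] at this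

/-- Swaps with no common index lead to states two swaps apart, so their covariance is a second
difference of `f` at `1`. Distinct swaps sharing an index would leave overlap `k - 1` and a
covariance only bounded by order `1 / k`. -/
lemma overlap_swap_swap {x : SparseSet p k} {e e' : Fin p × Fin p} (h1 : e.1 ∈ x.1)
    (h2 : e.2 ∉ x.1) (h1' : e'.1 ∈ x.1) (h2' : e'.2 ∉ x.1) (hne1 : e.1 ≠ e'.1)
    (hne2 : e.2 ≠ e'.2) : overlap (swap x e) (swap x e') + 2 = k := by
  have h3 := overlap_swap x (swap x e') h1 h2
  have h4 := overlap_swap_self h1' h2'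
  have h5 : e.1 ∈ (swap x e').1 := by
    rw [swap_val h1' h2']
    exact Finset.mem_insert_of_mem (Finset.mem_erase.2 ⟨hne1, h1⟩)
  have h6 : e.2 ∉ (swap x e').1 := by
    rw [swap_val h1' h2', Finset.mem_insert, Finset.mem_erase]
    tauto
  rw [if_pos h5, if_neg h6, overlap_comm x] at h3
  omega

/-- The sum over the moves `e ∈ S` of the feature increments from `x` along `e`. -/
def incrementSum (F : EuclideanSpace ℝ (Fin p) → EuclideanSpace ℝ (Fin d))
    (x : SparseSet p k) (S : Finset (Fin p × Fin p)) : EuclideanSpace ℝ (Fin d) :=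
  ∑ e ∈ S, (F (normalizedVec (swap x e)) - F (normalizedVec x))

lemma inner_incrementSum (x : SparseSet p k) (S : Finset (Fin p × Fin p))
    (W : EuclideanSpace ℝ (Fin d)) :
    inner ℝ (incrementSum F x S) W = ∑ e ∈ S, (noise F W (swap x e) - noise F W x) := by
  rw [incrementSum, sum_inner]
  simp only [inner_sub_left]
  rfl

/-- Each diagonal term is at most `2 * M / k`. Each off-diagonal term is of order at most `1 / k ^
2`, and a row has at most `k` of them because a matching uses distinct elements of the support of
`x`. Hence the variance grows linearly, not quadratically, in the size of the matching. -/
lemma norm_incrementSum_sq_le {ε t c M : ℝ} (h : LinkAssumption f ε t c M) (hε₀ : 0 < ε)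
    (hε₁ : ε < 1) (hM : 0 < M) (hF : IsFeatureMap f F) (hk : 0 < k) {x v : SparseSet p k}
    {S : Finset (Fin p × Fin p)} (hS : S ⊆ upMoves x v) (hmatch : IsMatching S) :
    ‖incrementSum F x S‖ ^ 2 ≤ S.card * ((2 * M + 2 * M / ε) / k) := by
  have hk' : (0 : ℝ) < k := by exact_mod_cast hk
  have hmem : ∀ e ∈ S, e.1 ∈ x.1 ∧ e.2 ∉ x.1 := fun e he =>
    ⟨(mem_upMoves.1 (hS he)).1.1, (mem_upMoves.1 (hS he)).2.2⟩
  have hcard : S.card ≤ k := by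
    have h1 : S.card = (S.image Prod.fst).card := by
      rw [Finset.card_image_of_injOn]
      intro e he e' he' hee
      by_contra hne
      exact (hmatch e he e' he' hne).1 hee
    rw [h1, ← x.2]
    refine Finset.card_le_card fun i hi => ?_
    obtain ⟨e, he, rfl⟩ := Finset.mem_image.1 hi
    exact (hmem e he).1
  have hcard' : (S.card : ℝ) ≤ k := by exact_mod_cast hcard
  have hexp : ∀ e ∈ S, ∀ e' ∈ S,
      inner ℝ (F (normalizedVec (swap x e)) - F (normalizedVec x))
        (F (normalizedVec (swap x e')) - F (normalizedVec x)) =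
      f ((overlap (swap x e) (swap x e') : ℝ) / k) - 2 * f (1 - 1 / k) + f 1 := by
    intro e he e' he'
    have h1 : ∀ e ∈ S, (overlap (swap x e) x : ℝ) / k = 1 - 1 / k := by
      intro e he
      have : (overlap (swap x e) x : ℝ) + 1 = k := by
        exact_mod_cast overlap_swap_self (hmem e he).1 (hmem e he).2
      rw [eq_sub_iff_add_eq, ← add_div, this, div_self hk'.ne']
    rw [inner_sub_left, inner_sub_right, inner_sub_right, inner_feature hF hk,
      inner_feature hF hk, inner_feature hF hk, inner_feature hF hk, overlap_self,
      div_self hk'.ne', overlap_comm x (swap x e'), h1 e he, h1 e' he']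
    ring
  have hdiag : ∀ e ∈ S, inner ℝ (F (normalizedVec (swap x e)) - F (normalizedVec x))
        (F (normalizedVec (swap x e)) - F (normalizedVec x)) ≤ 2 * M / k := by
    intro e he
    rw [hexp e he e he, overlap_self, div_self hk'.ne']
    have := h.sub_le_mul (s := 1 / (k : ℝ)) (by positivity)
      (div_le_one_of_le₀ (by exact_mod_cast hk) hk'.le)
    have e1 : 2 * M / k = 2 * (M * (1 / k)) := by ring
    linarith
  have hoff : ∀ e ∈ S, ∀ e' ∈ S, e' ≠ e →
      inner ℝ (F (normalizedVec (swap x e)) - F (normalizedVec x))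
        (F (normalizedVec (swap x e')) - F (normalizedVec x)) ≤ 2 * M / ε / k ^ 2 := by
    intro e he e' he' hne
    have hd := hmatch e he e' he' hne.symm
    have h2 := overlap_swap_swap (hmem e he).1 (hmem e he).2 (hmem e' he').1 (hmem e' he').2
      hd.1 hd.2
    have h3 : (overlap (swap x e) (swap x e') : ℝ) + 2 = k := by exact_mod_cast h2
    have h4 : (2 : ℝ) ≤ k := by exact_mod_cast (show 2 ≤ k by omega)
    have h5 : (overlap (swap x e) (swap x e') : ℝ) / k = 1 - 2 * (1 / k) := by
      rw [eq_sub_iff_add_eq, mul_one_div, ← add_div, h3, div_self hk'.ne']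
    rw [hexp e he e' he', h5]
    have h6 := h.second_diff_le hε₀ hε₁ hM (s := 1 / (k : ℝ)) (by positivity)
      (by rw [mul_one_div]; exact div_le_one_of_le₀ h4 hk'.le)
    have e1 : 2 * M / ε / k ^ 2 = 2 * M / ε * (1 / k) ^ 2 := by rw [one_div, inv_pow]; rfl
    linarith
  rw [← real_inner_self_eq_norm_sq, incrementSum, sum_inner]
  rw [← nsmul_eq_mul]
  refine Finset.sum_le_card_nsmul _ _ _ fun e he => ?_
  rw [inner_sum, ← Finset.add_sum_erase _ _ he]
  have h7 : ∑ e' ∈ S.erase e, inner ℝ (F (normalizedVec (swap x e)) - F (normalizedVec x))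
        (F (normalizedVec (swap x e')) - F (normalizedVec x)) ≤ k * (2 * M / ε / k ^ 2) := by
    refine (Finset.sum_le_card_nsmul _ _ (2 * M / ε / k ^ 2) fun e' he' =>
      hoff e he e' (Finset.mem_of_mem_erase he') (Finset.ne_of_mem_erase he')).trans ?_
    rw [nsmul_eq_mul]
    refine mul_le_mul_of_nonneg_right ?_ (by positivity)
    refine le_trans ?_ hcard'
    exact_mod_cast Finset.card_le_card (Finset.erase_subset e S)
  have e1 : (2 * M + 2 * M / ε) / k = 2 * M / k + k * (2 * M / ε / k ^ 2) := by
    field_simp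
  rw [e1]
  exact add_le_add (hdiag e he) h7

open Classical in
/-- The moves towards `v` along which the noise decreases by at least `τ`. -/
def badMoves (F : EuclideanSpace ℝ (Fin p) → EuclideanSpace ℝ (Fin d)) (τ : ℝ)
    (W : EuclideanSpace ℝ (Fin d)) (x v : SparseSet p k) : Finset (Fin p × Fin p) :=
  (upMoves x v).filter fun e => noise F W (swap x e) - noise F W x ≤ -τ

/-- Many bad moves contain a large matching. -/
lemma exists_matching {x v : SparseSet p k} {B : Finset (Fin p × Fin p)} (hB : B ⊆ upMoves x v)
    (hcard : ((k : ℝ) - overlap x v) ^ 2 / 8 < B.card) :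
    ∃ S ⊆ B, IsMatching S ∧ S.Nonempty ∧ k - overlap x v ≤ 16 * S.card := by
  classical
  -- A matching of maximal size meets every move of `B` in its removed or its added index. Each of
  -- its `2 * S.card` indices lies on at most `m` upward moves, so `B` has at most `2 * S.card * m`
  -- elements.
  obtain ⟨S, hS, hmax⟩ := Finset.exists_max_image (B.powerset.filter IsMatching) Finset.card
    ⟨∅, by simp [IsMatching]⟩
  rw [Finset.mem_filter, Finset.mem_powerset] at hS
  obtain ⟨hSB, hSm⟩ := hS
  have hcover : ∀ e ∈ B, e.1 ∈ S.image Prod.fst ∨ e.2 ∈ S.image Prod.snd := by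
    intro e he
    by_contra hcon
    push Not at hcon
    have heS : e ∉ S := fun h => hcon.1 (Finset.mem_image_of_mem _ h)
    have h1 : IsMatching (insert e S) := by
      intro a ha b hb hab
      rw [Finset.mem_insert] at ha hb
      rcases ha with rfl | ha <;> rcases hb with rfl | hb
      · exact absurd rfl hab
      · exact ⟨fun h => hcon.1 (h ▸ Finset.mem_image_of_mem _ hb),
          fun h => hcon.2 (h ▸ Finset.mem_image_of_mem _ hb)⟩
      · exact ⟨fun h => hcon.1 (h ▸ Finset.mem_image_of_mem _ ha),
          fun h => hcon.2 (h ▸ Finset.mem_image_of_mem _ ha)⟩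
      · exact hSm a ha b hb hab
    have h2 := hmax (insert e S) (by
      rw [Finset.mem_filter, Finset.mem_powerset]
      exact ⟨Finset.insert_subset he hSB, h1⟩)
    rw [Finset.card_insert_of_notMem heS] at h2
    omega
  have hx := card_sdiff_add_overlap x v
  have hv := card_sdiff_add_overlap v x
  rw [overlap_comm] at hv
  set m := (x.1 \ v.1).card with hm
  have hmv : (v.1 \ x.1).card = m := by omega
  have hBcard : B.card ≤ 2 * S.card * m := by
    have hsub : B ⊆ (S.image Prod.fst ×ˢ (v.1 \ x.1)) ∪ ((x.1 \ v.1) ×ˢ S.image Prod.snd) := by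
      intro e he
      have h1 := Finset.mem_product.1 (hB he)
      rw [Finset.mem_union, Finset.mem_product, Finset.mem_product]
      rcases hcover e he with h | h
      · exact Or.inl ⟨h, h1.2⟩
      · exact Or.inr ⟨h1.1, h⟩
    refine (Finset.card_le_card hsub).trans ((Finset.card_union_le _ _).trans ?_)
    rw [Finset.card_product, Finset.card_product, hmv, ← hm]
    have h1 := Nat.mul_le_mul_right m (Finset.card_image_le (s := S) (f := Prod.fst))
    have h2 := Nat.mul_le_mul_left m (Finset.card_image_le (s := S) (f := Prod.snd))
    nlinarith
  have hkm : (k : ℝ) - overlap x v = m := by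
    rw [sub_eq_iff_eq_add]; exact_mod_cast hx.symm
  rw [hkm] at hcard
  have hlt : m ^ 2 < 16 * S.card * m := by
    have h1 : (B.card : ℝ) ≤ 2 * S.card * m := by exact_mod_cast hBcard
    have h2 : (m : ℝ) ^ 2 < 16 * S.card * m := by linarith
    exact_mod_cast h2
  have hlt' : m < 16 * S.card := by
    by_contra hge
    push Not at hge
    nlinarith
  refine ⟨S, hSB, hSm, ?_, by omega⟩
  rw [← Finset.card_pos]
  omega

/-! ### Union bounds for the noise -/

lemma sum_finset_pow (α : Type*) [Fintype α] (r : ℝ) :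
    ∑ S : Finset α, r ^ S.card = (1 + r) ^ Fintype.card α := by
  have := Fintype.sum_pow_mul_eq_add_pow α r 1
  simpa [add_comm] using this

/-- A state is determined by its symmetric difference with `v`, so the sum is part of a sum over all
subsets of `Fin p`. States far from `v` are more numerous but carry a smaller weight. -/
lemma sum_symmDiff_pow_le (v : SparseSet p k) {r : ℝ} (hr : 0 ≤ r) :
    ∑ x : SparseSet p k, r ^ (symmDiff x.1 v.1).card ≤ (1 + r) ^ p := by
  classical
  have h1 := sum_finset_pow (Fin p) r
  rw [Fintype.card_fin] at h1
  rw [← h1]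
  have hinj : Set.InjOn (fun x : SparseSet p k => symmDiff x.1 v.1)
      (Finset.univ : Finset (SparseSet p k)) := by
    intro x _ y _ hxy
    exact Subtype.ext (symmDiff_left_injective v.1 hxy)
  rw [← Finset.sum_image (f := fun D : Finset (Fin p) => r ^ D.card) hinj]
  exact Finset.sum_le_univ_sum_of_nonneg fun D => by positivity

lemma card_symmDiff (x v : SparseSet p k) :
    (symmDiff x.1 v.1).card = 2 * (k - overlap x v) := by
  have hx := card_sdiff_add_overlap x v
  have hv := card_sdiff_add_overlap v x
  rw [overlap_comm] at hv
  rw [symmDiff_def, Finset.sup_eq_union, Finset.card_union_of_disjoint disjoint_sdiff_sdiff]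
  omega

/-- Uniform control of the noise: it is at most `b`, and from every state at most one eighth of
the moves towards `v` decrease it by `τ` or more. -/
structure NoiseBound (F : EuclideanSpace ℝ (Fin p) → EuclideanSpace ℝ (Fin d))
    (v : SparseSet p k) (b τ : ℝ) (W : EuclideanSpace ℝ (Fin d)) : Prop where
  abs_le : ∀ x : SparseSet p k, |noise F W x| ≤ b
  card_le : ∀ x : SparseSet p k,
    ((badMoves F τ W x v).card : ℝ) ≤ ((k : ℝ) - overlap x v) ^ 2 / 8

/-- There are at most `p ^ k` states, each with noise variance `f 1 ≤ M`. The threshold makes each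
one-sided tail at most `p ^ (-3k)`. -/
lemma measure_noise_gt_le {ε t c M : ℝ} (h : LinkAssumption f ε t c M) (hM : 0 < M)
    (hF : IsFeatureMap f F) (hk : 0 < k) (hp : 2 ≤ p) :
    (stdGaussian (EuclideanSpace ℝ (Fin d))).real
      {W | ∃ x : SparseSet p k, √(6 * M * k * Real.log p) < |noise F W x|} ≤ 2 / (p : ℝ) := by
  classical
  have hp' : (2 : ℝ) ≤ p := by exact_mod_cast hp
  have hk' : (1 : ℝ) ≤ k := by exact_mod_cast hk
  have hlog : 0 < Real.log p := Real.log_pos (by linarith)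
  set b := √(6 * M * k * Real.log p) with hb
  have hb2 : b ^ 2 = 6 * M * k * Real.log p := Real.sq_sqrt (by positivity)
  have hnorm : ∀ x : SparseSet p k, ‖F (normalizedVec x)‖ ^ 2 ≤ M := by
    intro x
    rw [← real_inner_self_eq_norm_sq, inner_feature hF hk, overlap_self,
      div_self (by positivity)]
    exact h.map_one_le
  have hexp : -(b / M * b) + (b / M) ^ 2 * M / 2 = -(3 * k * Real.log p) := by
    have : -(b / M * b) + (b / M) ^ 2 * M / 2 = -(b ^ 2) / (2 * M) := by field_simp; ring
    rw [this, hb2]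
    field_simp
    ring
  have hpow : Real.exp (-(3 * k * Real.log p)) = 1 / ((p : ℝ) ^ k) ^ 3 := by
    rw [Real.exp_neg, one_div, ← pow_mul, mul_comm (3 * (k : ℝ)), Real.exp_mul,
      Real.exp_log (by linarith), ← Real.rpow_natCast]
    congr 2
    push_cast
    ring
  have htail : ∀ x : SparseSet p k, (stdGaussian (EuclideanSpace ℝ (Fin d))).real
      {W | b < |noise F W x|} ≤ 2 * (1 / ((p : ℝ) ^ k) ^ 3) := by
    intro x
    have h1 := stdGaussian_real_le_inner (F (normalizedVec x)) (b := b) (hnorm x)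
      (show 0 ≤ b / M by positivity)
    have h2 := stdGaussian_real_le_inner (-F (normalizedVec x)) (s := M) (b := b)
      (by rw [norm_neg]; exact hnorm x) (show 0 ≤ b / M by positivity)
    rw [hexp, hpow] at h1 h2
    refine (measureReal_mono (s₂ := {w | b ≤ inner ℝ (F (normalizedVec x)) w} ∪
      {w | b ≤ inner ℝ (-F (normalizedVec x)) w}) ?_).trans
        ((measureReal_union_le _ _).trans (by linarith))
    intro W hW
    rw [Set.mem_ofPred_eq, lt_abs] at hW
    rcases hW with hW | hW
    · exact Or.inl hW.le
    · refine Or.inr ?_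
      rw [Set.mem_ofPred_eq, inner_neg_left]
      exact hW.le
  have hset : {W | ∃ x : SparseSet p k, b < |noise F W x|} ⊆
      ⋃ x ∈ (Finset.univ : Finset (SparseSet p k)), {W | b < |noise F W x|} := by
    rintro W ⟨x, hx⟩
    simp only [Set.mem_iUnion]
    exact ⟨x, Finset.mem_univ x, hx⟩
  refine (measureReal_mono hset (measure_ne_top _ _)).trans ((measureReal_biUnion_finset_le _ _).trans ?_)
  refine (Finset.sum_le_card_nsmul _ _ _ fun x _ => htail x).trans ?_
  have hcard : (Fintype.card (SparseSet p k) : ℝ) ≤ (p : ℝ) ^ k := by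
    have h1 : Fintype.card (SparseSet p k) = p.choose k := by
      rw [Fintype.card_finset_len, Fintype.card_fin]
    rw [h1]
    exact_mod_cast Nat.choose_le_pow p k
  have hq : (p : ℝ) ≤ (p : ℝ) ^ k := le_self_pow₀ (by linarith) hk.ne'
  rw [nsmul_eq_mul, Finset.card_univ]
  set q := (p : ℝ) ^ k
  have hq0 : 0 < q := by linarith
  calc (Fintype.card (SparseSet p k) : ℝ) * (2 * (1 / q ^ 3)) ≤ q * (2 * (1 / q ^ 3)) :=
        mul_le_mul_of_nonneg_right hcard (by positivity)
    _ = 2 / q * (1 / q) := by field_simp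
    _ ≤ 2 / q * 1 := by
        refine mul_le_mul_of_nonneg_left ?_ (by positivity)
        exact div_le_one_of_le₀ (by linarith) hq0.le
    _ ≤ 2 / p := by
        rw [mul_one]
        exact div_le_div_of_nonneg_left (by norm_num) (by linarith) hq

/-- Too many bad moves at `x` yield a matching `S` of size at least `(k - overlap x v) / 16` along
which the total noise drops by `S.card * τ`. The probability of this is at most `p ^ (-99 *
S.card)`, which pays for the choice of both `x` and `S`. -/
lemma measure_badMoves_le {ε t c M : ℝ} (h : LinkAssumption f ε t c M) (hε₀ : 0 < ε)
    (hε₁ : ε < 1) (hM : 0 < M) (hF : IsFeatureMap f F) (hk : 0 < k) (hp : 2 ≤ p)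
    (v : SparseSet p k) :
    (stdGaussian (EuclideanSpace ℝ (Fin d))).real {W | ∃ x : SparseSet p k,
      ((k : ℝ) - overlap x v) ^ 2 / 8 <
        (badMoves F √(198 * (2 * M + 2 * M / ε) * Real.log p / k) W x v).card} ≤ 6 / (p : ℝ) := by
  classical
  have hp' : (2 : ℝ) ≤ p := by exact_mod_cast hp
  have hk' : (1 : ℝ) ≤ k := by exact_mod_cast hk
  have hlog : 0 < Real.log p := Real.log_pos (by linarith)
  set A := 2 * M + 2 * M / ε with hA
  have hA0 : 0 < A := by positivity
  set τ := √(198 * A * Real.log p / k) with hτ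
  have hτ2 : τ ^ 2 = 198 * A * Real.log p / k := Real.sq_sqrt (by positivity)
  -- The price of each index in the symmetric difference of `x` and `v` and of each move in `S`; it
  -- is small even against the `p ^ 2` possible moves.
  set r : ℝ := 1 / (p : ℝ) ^ 3 with hr
  have hr0 : 0 < r := by positivity
  have hr1 : r ≤ 1 := div_le_one_of_le₀ (one_le_pow₀ (by linarith)) (by positivity)
  let I : SparseSet p k → Finset (Finset (Fin p × Fin p)) := fun x =>
    Finset.univ.filter fun S => S ⊆ upMoves x v ∧ IsMatching S ∧ S.Nonempty ∧
      k - overlap x v ≤ 16 * S.card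
  have hset : {W | ∃ x : SparseSet p k, ((k : ℝ) - overlap x v) ^ 2 / 8 <
      (badMoves F τ W x v).card} ⊆ ⋃ x ∈ (Finset.univ : Finset (SparseSet p k)),
        ⋃ S ∈ I x, {W | S.card * τ ≤ inner ℝ (-incrementSum F x S) W} := by
    rintro W ⟨x, hx⟩
    obtain ⟨S, hS, hm, hne, hc⟩ := exists_matching (Finset.filter_subset _ _) hx
    simp only [Set.mem_iUnion]
    refine ⟨x, Finset.mem_univ x, S, Finset.mem_filter.2 ⟨Finset.mem_univ S,
      hS.trans (Finset.filter_subset _ _), hm, hne, hc⟩, ?_⟩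
    rw [Set.mem_ofPred_eq, inner_neg_left, inner_incrementSum, ← Finset.sum_neg_distrib,
      ← nsmul_eq_mul]
    refine Finset.card_nsmul_le_sum _ _ _ fun e he => ?_
    have := (Finset.mem_filter.1 (hS he)).2
    linarith
  have htail : ∀ x : SparseSet p k, ∀ S ∈ I x,
      (stdGaussian (EuclideanSpace ℝ (Fin d))).real
        {W | S.card * τ ≤ inner ℝ (-incrementSum F x S) W} ≤
      r ^ (symmDiff x.1 v.1).card * r ^ S.card := by
    intro x S hS
    obtain ⟨hSup, hSm, -, hSc⟩ := (Finset.mem_filter.1 hS).2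
    have hn := norm_incrementSum_sq_le h hε₀ hε₁ hM hF hk hSup hSm
    refine (stdGaussian_real_le_inner (-incrementSum F x S) (s := S.card * (A / k)) (b := S.card * τ)
      (by rw [norm_neg]; exact hn) (show 0 ≤ k * τ / A by positivity)).trans ?_
    have e1 : -(k * τ / A * (S.card * τ)) + (k * τ / A) ^ 2 * (S.card * (A / k)) / 2 =
        -(S.card * k * τ ^ 2 / (2 * A)) := by field_simp; ring
    rw [e1, hτ2]
    have e2 : -(S.card * k * (198 * A * Real.log p / k) / (2 * A)) =
        -(Real.log p * ((99 * S.card : ℕ) : ℝ)) := by push_cast; field_simp; ring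
    rw [e2, Real.exp_neg, Real.exp_mul, Real.exp_log (by linarith), Real.rpow_natCast,
      ← pow_add, hr, one_div, inv_pow, ← pow_mul]
    -- The symmetric difference has size at most `32 * S.card`, and `99 = 3 * (32 + 1)`; this is the
    -- origin of `198 = 2 * 99` in `τ`.
    refine inv_anti₀ (by positivity) (pow_le_pow_right₀ (by linarith) ?_)
    rw [card_symmDiff]
    omega
  have hsum : (stdGaussian (EuclideanSpace ℝ (Fin d))).real {W | ∃ x : SparseSet p k,
      ((k : ℝ) - overlap x v) ^ 2 / 8 < (badMoves F τ W x v).card} ≤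
      (1 + r) ^ p * ((1 + r) ^ (p * p) - 1) := by
    refine (measureReal_mono hset (measure_ne_top _ _)).trans ((measureReal_biUnion_finset_le _ _).trans ?_)
    calc ∑ x : SparseSet p k, (stdGaussian (EuclideanSpace ℝ (Fin d))).real
          (⋃ S ∈ I x, {W | S.card * τ ≤ inner ℝ (-incrementSum F x S) W})
        ≤ ∑ x : SparseSet p k, r ^ (symmDiff x.1 v.1).card * ((1 + r) ^ (p * p) - 1) := by
          refine Finset.sum_le_sum fun x _ => (measureReal_biUnion_finset_le _ _).trans ?_
          refine (Finset.sum_le_sum fun S hS => htail x S hS).trans ?_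
          rw [← Finset.mul_sum]
          refine mul_le_mul_of_nonneg_left ?_ (by positivity)
          -- The matchings are nonempty, so the term of the empty set can be removed. What remains,
          -- `(1 + r) ^ (p * p) - 1`, is of order `1 / p`.
          have h1 := sum_finset_pow (Fin p × Fin p) r
          rw [Fintype.card_prod, Fintype.card_fin,
            ← Finset.add_sum_erase _ _ (Finset.mem_univ ∅), Finset.card_empty, pow_zero] at h1
          rw [← h1, add_sub_cancel_left]
          refine Finset.sum_le_sum_of_subset_of_nonneg ?_ fun _ _ _ => by positivity
          intro S hS
          exact Finset.mem_erase.2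
            ⟨(Finset.mem_filter.1 hS).2.2.2.1.ne_empty, Finset.mem_univ S⟩
      _ ≤ (1 + r) ^ p * ((1 + r) ^ (p * p) - 1) := by
          rw [← Finset.sum_mul]
          refine mul_le_mul_of_nonneg_right (sum_symmDiff_pow_le v hr0.le) ?_
          exact sub_nonneg.2 (one_le_pow₀ (by linarith))
  refine hsum.trans ?_
  have hpow : ∀ n : ℕ, (1 + r) ^ n ≤ Real.exp (r * n) := by
    intro n
    rw [Real.exp_mul, Real.rpow_natCast]
    refine pow_le_pow_left₀ (by linarith) ?_ n
    linarith [Real.add_one_le_exp r]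
  have hexp : ∀ z : ℝ, 0 ≤ z → z ≤ 1 → Real.exp z - 1 ≤ 2 * z := by
    intro z h0 h1
    have := Real.abs_exp_sub_one_le (x := z) (by rw [abs_of_nonneg h0]; exact h1)
    rw [abs_of_nonneg h0] at this
    exact (le_abs_self _).trans this
  have hrp : r * ((p * p : ℕ) : ℝ) = 1 / p := by rw [hr]; push_cast; field_simp
  have hp1 : 1 / (p : ℝ) ≤ 1 := div_le_one_of_le₀ (by linarith) (by linarith)
  have h1 : (1 + r) ^ (p * p) - 1 ≤ 2 * (1 / p) := by
    have h2 := hpow (p * p)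
    rw [hrp] at h2
    have h3 := hexp (1 / p) (by positivity) hp1
    linarith
  have h4 : (1 + r) ^ p ≤ 3 := by
    have h5 : (1 + r) ^ p ≤ (1 + r) ^ (p * p) :=
      pow_le_pow_right₀ (by linarith) (Nat.le_mul_self p)
    linarith
  calc (1 + r) ^ p * ((1 + r) ^ (p * p) - 1) ≤ 3 * (2 * (1 / p)) :=
        mul_le_mul h4 h1 (sub_nonneg.2 (one_le_pow₀ (by linarith))) (by norm_num)
    _ = 6 / p := by ring

lemma measure_not_noiseBound_le {ε t c M : ℝ} (h : LinkAssumption f ε t c M) (hε₀ : 0 < ε)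
    (hε₁ : ε < 1) (hM : 0 < M) (hF : IsFeatureMap f F) (hk : 0 < k) (hp : 2 ≤ p)
    (v : SparseSet p k) :
    stdGaussian (EuclideanSpace ℝ (Fin d)) {W | ¬ NoiseBound F v √(6 * M * k * Real.log p)
      √(198 * (2 * M + 2 * M / ε) * Real.log p / k) W} ≤ ENNReal.ofReal (8 / p) := by
  rw [ENNReal.le_ofReal_iff_toReal_le (measure_ne_top _ _) (by positivity)]
  have h1 := measure_noise_gt_le h hM hF hk hp
  have h2 := measure_badMoves_le h hε₀ hε₁ hM hF hk hp v
  refine (measureReal_mono ?_).trans ((measureReal_union_le _ _).trans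
    ((add_le_add h1 h2).trans_eq (by ring)))
  intro W hW
  by_contra hcon
  rw [Set.mem_union, not_or, Set.mem_ofPred_eq, Set.mem_ofPred_eq] at hcon
  push Not at hcon
  exact hW ⟨hcon.1, hcon.2⟩

/-- Conditioning on the signal for a possibly non-measurable event: each of the finitely many slices
is replaced by its measurable hull. -/
lemma law_le_of_forall {A : Set (SparseSet p k × EuclideanSpace ℝ (Fin d))} {q : ENNReal}
    (hA : ∀ v, stdGaussian (EuclideanSpace ℝ (Fin d)) {W | (v, W) ∈ A} ≤ q) :
    law p k d A ≤ q := by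
  let μ := stdGaussian (EuclideanSpace ℝ (Fin d))
  let B : Set (SparseSet p k × EuclideanSpace ℝ (Fin d)) :=
    ⋃ v, {v} ×ˢ toMeasurable μ {W | (v, W) ∈ A}
  have hB : MeasurableSet B := MeasurableSet.iUnion fun v =>
    (measurableSet_singleton v).prod (measurableSet_toMeasurable _ _)
  have hAB : A ⊆ B := by
    rintro ⟨v, W⟩ hW
    rw [Set.mem_iUnion]
    exact ⟨v, rfl, subset_toMeasurable _ _ hW⟩
  have hslice : ∀ v, μ (Prod.mk v ⁻¹' B) ≤ q := by
    intro v
    have : Prod.mk v ⁻¹' B = toMeasurable μ {W | (v, W) ∈ A} := by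
      ext W
      simp [B]
    rw [this, measure_toMeasurable]
    exact hA v
  calc law p k d A ≤ law p k d B := measure_mono hAB
    _ = ∫⁻ v, μ (Prod.mk v ⁻¹' B) ∂(uniformOn Set.univ) := Measure.prod_apply hB
    _ ≤ ∫⁻ _v, q ∂(uniformOn (Set.univ : Set (SparseSet p k))) := lintegral_mono hslice
    _ ≤ q := by
        rw [lintegral_const]
        exact mul_le_of_le_one_right zero_le (by
          rw [uniformOn]; exact prob_le_one)

end Noise

/-! ### Low-temperature chains on the event of bounded noise -/

section FixedSize

variable {p k d : ℕ} {f : ℝ → ℝ} {ε t c M : ℝ}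
  {F : EuclideanSpace ℝ (Fin p) → EuclideanSpace ℝ (Fin d)}

/-- The constant in the lower bound on the gain of the signal in one move. -/
def signalConst (ε t c : ℝ) : ℝ := c / 2 * (ε / 2) ^ (t - 1)

lemma signalConst_pos (hε₀ : 0 < ε) (hc : 0 < c) : 0 < signalConst ε t c :=
  mul_pos (half_pos hc) (Real.rpow_pos_of_pos (half_pos hε₀) _)

/-- The shift by `1 / 2` in the overlap condition makes it hold for every overlap when `ℓ = 1`,
overlap zero included. -/
lemma LinkAssumption.increment_ge_signalConst (h : LinkAssumption f ε t c M) (hε₀ : 0 < ε)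
    (hε₁ : ε < 1) (ht : 1 ≤ t) (hc : 0 < c) {ℓ o k : ℝ} (hk : 0 < k) (hℓ : 0 < ℓ) (ho : 0 ≤ o)
    (hok : o + 1 ≤ k) (hoℓ : ℓ / 2 ≤ o + 1 / 2) :
    signalConst ε t c * ℓ ^ (t - 1) / k ^ t ≤ f ((o + 1) / k) - f (o / k) := by
  refine le_trans ?_ (h.increment_ge hε₀ hε₁ hk ho hok)
  have h1 : k ^ t = k * k ^ (t - 1) := by
    rw [← Real.rpow_one_add' hk.le (by linarith)]
    congr 1
    ring
  have h2 : signalConst ε t c * ℓ ^ (t - 1) / k ^ t =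
      c / (2 * k) * (ε * ((ℓ / 2) / k)) ^ (t - 1) := by
    rw [show ε * ((ℓ / 2) / k) = (ε / 2) * ℓ / k by ring, Real.div_rpow (by positivity) hk.le,
      Real.mul_rpow (by positivity) hℓ.le, signalConst, h1]
    have : k ^ (t - 1) ≠ 0 := (Real.rpow_pos_of_pos hk _).ne'
    field_simp
  rw [h2]
  refine mul_le_mul_of_nonneg_left ?_ (by positivity)
  exact Real.rpow_le_rpow (by positivity) (by gcongr) (by linarith)

open Classical in
-- Deterministic given the noise bound. The good swaps provide the gain `δ` for the entropy
-- argument, and, being seven eighths of the upward swaps and always accepted, they also keep the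
-- overlap typical.
theorem two_thirds_le_hitProb_of_noiseBound (h : LinkAssumption f ε t c M) (hε₀ : 0 < ε)
    (hε₁ : ε < 1) (ht : 1 ≤ t) (hc : 0 < c) (hF : IsFeatureMap f F) (hp : 2 ≤ p) (hk : 0 < k)
    (hkp : k ≤ p) {lam ℓ b τ β : ℝ} (hℓ : 0 < ℓ) (hlam : 0 < lam) {v : SparseSet p k}
    {W : EuclideanSpace ℝ (Fin d)} (hW : NoiseBound F v b τ W) (hb : 2 * b ≤ lam)
    (hτ : τ ≤ lam * (signalConst ε t c * ℓ ^ (t - 1) / k ^ t) / 2)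
    (hβ : 16 * Real.log p ≤ β * (lam * (signalConst ε t c * ℓ ^ (t - 1) / k ^ t) / 2)) {N : ℕ}
    (hN : 48 * (M + 1) / signalConst ε t c * ((k : ℝ) ^ (t + 1) / ℓ ^ (t - 1) * p) < N)
    (hℓN : ℓ = 1 ∨ ℓ = (k : ℝ) ^ 2 / p ∧
      16 / ℓ + N * (6 / 7 : ℝ) ^ (ℓ / 4 - 1 / 2) ≤ 1 / 6) :
    2 / 3 ≤ hitProb (uniformInit _)
      (metropolis (johnsonGraph p k) (hamiltonian F (observation F lam v W)) β) v N := by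
  have : Nonempty (SparseSet p k) := ⟨v⟩
  have hp' : (2 : ℝ) ≤ p := by exact_mod_cast hp
  have hk' : (0 : ℝ) < k := by exact_mod_cast hk
  have hkp' : (k : ℝ) ≤ p := by exact_mod_cast hkp
  have hM := h.bound_pos hε₀ hε₁ hc
  have hκ : 0 < signalConst ε t c := signalConst_pos hε₀ hc
  set κ := signalConst ε t c with hκdef
  set H := hamiltonian F (observation F lam v W) with hHdef
  have hlog : Real.log 2 ≤ Real.log p := Real.log_le_log (by norm_num) hp'
  have hlog2 := Real.log_two_gt_d9
  have hℓt : 0 < ℓ ^ (t - 1) := Real.rpow_pos_of_pos hℓ _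
  have hkt : 0 < (k : ℝ) ^ t := Real.rpow_pos_of_pos hk' _
  -- Half of the signal gain; the other half absorbs a noise decrease of up to `τ`.
  set δ := lam * (κ * ℓ ^ (t - 1) / k ^ t) / 2 with hδdef
  have hδ : 0 < δ := by positivity
  have hβ0 : 0 < β := by
    have : 0 < β * δ := by linarith
    exact pos_of_mul_pos_left this hδ.le
  have hbn : ∀ x : SparseSet p k, -b ≤ noise F W x ∧ noise F W x ≤ b := fun x =>
    abs_le.1 (hW.abs_le x)
  have hfval : ∀ x : SparseSet p k, 0 ≤ f ((overlap x v : ℝ) / k) ∧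
      f ((overlap x v : ℝ) / k) ≤ M := by
    intro x
    have h0 : 0 ≤ (overlap x v : ℝ) / k := by positivity
    have h1 : (overlap x v : ℝ) / k ≤ 1 :=
      div_le_one_of_le₀ (by exact_mod_cast overlap_le x v) hk'.le
    constructor
    · rw [← h.map_zero]
      exact h.monotoneOn ⟨le_rfl, zero_le_one⟩ ⟨h0, h1⟩ h0
    · exact (h.monotoneOn ⟨h0, h1⟩ ⟨zero_le_one, le_rfl⟩ h1).trans h.map_one_le
  have hosc : ∀ x y, H y - H x ≤ lam * (M + 1) := by
    intro x y
    rw [hHdef, hamiltonian_eq hF hk, hamiltonian_eq hF hk]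
    have h1 := mul_le_mul_of_nonneg_left (hfval y).2 hlam.le
    have h2 := mul_nonneg hlam.le (hfval x).1
    linarith [(hbn x).1, (hbn y).2]
  have hgain : ∀ x : SparseSet p k, ℓ / 2 ≤ overlap x v + 1 / 2 →
      ∀ e ∈ upMoves x v, e ∉ badMoves F τ W x v → H x + δ ≤ H (swap x e) := by
    intro x hx e he hbad
    have h1 : ¬ (noise F W (swap x e) - noise F W x ≤ -τ) := fun hle =>
      hbad (Finset.mem_filter.2 ⟨he, hle⟩)
    have h2 : (overlap x v : ℝ) + 1 ≤ k := by
      exact_mod_cast (overlap_swap_of_mem_upMoves he) ▸ overlap_le (swap x e) v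
    have h3 := h.increment_ge_signalConst hε₀ hε₁ ht hc hk' hℓ (Nat.cast_nonneg _) h2 hx
    rw [hHdef, hamiltonian_eq hF hk, hamiltonian_eq hF hk, overlap_swap_of_mem_upMoves he]
    push_cast
    have h4 := mul_le_mul_of_nonneg_left h3 hlam.le
    rw [mul_sub] at h4
    have h5 : lam * (signalConst ε t c * ℓ ^ (t - 1) / k ^ t) = 2 * δ := by
      rw [hδdef]; ring
    linarith
  set S := Finset.univ.filter fun x : SparseSet p k => ℓ / 2 ≤ overlap x v + 1 / 2 with hSdef
  have hdeg : (((johnsonGraph p k).maxDegree : ℕ) : ℝ) ≤ k * p := by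
    exact_mod_cast maxDegree_johnsonGraph_le
  refine two_thirds_le_hitProb_metropolis (johnsonGraph p k) (δ := δ) (B := lam * (M + 1))
    (S := S) hβ0 hosc ?_ ?_ ?_ ?_
  · intro x hx hxv
    have hox : (overlap x v : ℝ) < k := by exact_mod_cast overlap_lt_of_ne hxv
    have h1 : ((badMoves F τ W x v).card : ℝ) < (upMoves x v).card := by
      rw [card_upMoves]
      have := hW.card_le x
      nlinarith [mul_pos (sub_pos.2 hox) (sub_pos.2 hox)]
    obtain ⟨e, he, hbad⟩ := Finset.exists_mem_notMem_of_card_lt_card (Nat.cast_lt.1 h1)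
    have hm := mem_upMoves.1 he
    exact ⟨swap x e, adj_swap hm.1.1 hm.2.2, hgain x (Finset.mem_filter.1 hx).2 e he hbad⟩
  · intro n hn
    -- For `ℓ = 1` every state belongs to `S`; for `ℓ = k ^ 2 / p` the mass outside `S` is at most
    -- `1/6` by the overlap estimate.
    rcases hℓN with h1 | ⟨h1, h2⟩
    · have : S = Finset.univ := by
        rw [hSdef, Finset.filter_eq_self]
        intro x _
        rw [h1]
        linarith [(Nat.cast_nonneg (overlap x v) : (0 : ℝ) ≤ overlap x v)]
      rw [this, sum_chainLaw sum_uniformInit (metropolis_isStochastic _ H β)]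
      norm_num
    · rw [metropolis_eq]
      have h3 := sum_chainLaw_low_overlap_le (by omega : 0 < p) hk v
        (a := fun x y => min 1 (Real.exp (β * (H y - H x))))
        (fun _ _ => le_min zero_le_one (Real.exp_pos _).le) (fun _ _ => min_le_left _ _)
        (by
          intro x hx1 _
          rw [← h1] at hx1
          have hsub : upMoves x v \ badMoves F τ W x v ⊆ (upMoves x v).filter fun e =>
              min 1 (Real.exp (β * (H (swap x e) - H x))) = 1 := by
            intro e he
            rw [Finset.mem_sdiff] at he
            refine Finset.mem_filter.2 ⟨he.1, min_eq_left (Real.one_le_exp ?_)⟩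
            have := hgain x hx1 e he.1 he.2
            exact mul_nonneg hβ0.le (by linarith)
          have hle : ((upMoves x v).card : ℝ) - (badMoves F τ W x v).card ≤
              (upMoves x v \ badMoves F τ W x v).card := by
            rw [sub_le_iff_le_add]
            exact_mod_cast Finset.card_le_card_sdiff_add_card
          have hle2 : ((upMoves x v \ badMoves F τ W x v).card : ℝ) ≤ _ :=
            Nat.cast_le.2 (Finset.card_le_card hsub)
          rw [card_upMoves] at hle
          have := hW.card_le x
          linarith) n
      rw [← h1] at h3
      have h4 := sum_chainLaw sum_uniformInit (metropolis_isStochastic (johnsonGraph p k) H β) n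
      rw [metropolis_eq, ← Finset.sum_add_sum_compl S] at h4
      have hn' : (n : ℝ) + 1 ≤ N := by exact_mod_cast hn
      have := mul_le_mul_of_nonneg_right hn'
        (Real.rpow_pos_of_pos (by norm_num : (0 : ℝ) < 6 / 7) (ℓ / 4 - 1 / 2)).le
      linarith [h3.trans (add_le_add_right this _)]
  -- Since `β * δ / 2 ≥ 8 * log p`, the exponential is at most `p ^ (-8)`, which outweighs the
  -- degree, at most `p ^ 2`.
  · have h1 : Real.exp (-(β * δ / 2)) ≤ 1 / (p : ℝ) ^ 8 := by
      rw [one_div, ← Real.exp_log (show (0 : ℝ) < (p : ℝ) ^ 8 by positivity), ← Real.exp_neg,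
        Real.log_pow]
      refine Real.exp_le_exp.2 ?_
      push_cast
      linarith
    have h2 : Real.exp (-(β * δ / 2)) * ((johnsonGraph p k).maxDegree : ℝ) ≤
        1 / (p : ℝ) ^ 8 * (p * p) :=
      mul_le_mul h1 (hdeg.trans (mul_le_mul_of_nonneg_right hkp' (by positivity)))
        (by positivity) (by positivity)
    have h3 : 1 / (p : ℝ) ^ 8 * (p * p) = 1 / (p : ℝ) ^ 6 := by field_simp
    have h4 : 1 / (p : ℝ) ^ 6 ≤ 1 / 2 ^ 6 := by gcongr
    have h5 : (1 : ℝ) / 2 ^ 6 = 1 / 64 := by norm_num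
    rw [h3] at h2
    linarith
  · have hk1 : (k : ℝ) ^ (t + 1) = k ^ t * k := Real.rpow_add_one hk'.ne' t
    have h1 : (k : ℝ) * p * (lam * (M + 1)) =
        48 * (M + 1) / κ * ((k : ℝ) ^ (t + 1) / ℓ ^ (t - 1) * p) * (δ / 24) := by
      rw [hk1, hδdef]
      field_simp
      ring
    calc ((johnsonGraph p k).maxDegree : ℝ) * (lam * (M + 1))
        ≤ k * p * (lam * (M + 1)) := mul_le_mul_of_nonneg_right hdeg (by positivity)
      _ < N * (δ / 24) := by
          rw [h1]
          exact mul_lt_mul_of_pos_right hN (by positivity)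

end FixedSize

/-! ### Asymptotics -/

section Asymptotic

lemma LinkAssumption.mono {f : ℝ → ℝ} {ε t c M M' : ℝ} (h : LinkAssumption f ε t c M)
    (hM : M ≤ M') : LinkAssumption f ε t c M' where
  contDiffOn := h.contDiffOn
  monotoneOn := h.monotoneOn
  convexOn := h.convexOn
  map_zero := h.map_zero
  map_one_le := h.map_one_le.trans hM
  le_deriv := h.le_deriv
  deriv_one_le := h.deriv_one_le.trans hM
  deriv_two_le := fun x hx => (h.deriv_two_le x hx).trans hM

lemma typicalOverlap_eq_one_or (k : ℕ → ℕ) :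
    (∀ p, typicalOverlap k p = 1) ∨
      ¬ SparseRegime k ∧ ∀ p, typicalOverlap k p = (k p : ℝ) ^ 2 / p := by
  by_cases h : SparseRegime k
  · exact Or.inl fun p => by rw [typicalOverlap, if_pos h]
  · exact Or.inr ⟨h, fun p => by rw [typicalOverlap, if_neg h]⟩

lemma typicalOverlap_pos_le {k : ℕ → ℕ} {p : ℕ} (hk : 1 ≤ k p) (hkp : k p ≤ p) :
    0 < typicalOverlap k p ∧ typicalOverlap k p ≤ k p := by
  have hk' : (1 : ℝ) ≤ k p := by exact_mod_cast hk
  have hkp' : (k p : ℝ) ≤ p := by exact_mod_cast hkp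
  rcases typicalOverlap_eq_one_or k with h | ⟨-, h⟩
  · rw [h p]
    exact ⟨one_pos, hk'⟩
  · rw [h p]
    have hp : (0 : ℝ) < p := by linarith
    refine ⟨by positivity, ?_⟩
    rw [div_le_iff₀ hp]
    nlinarith

/-- The square of the defining asymptotic relation. Exponential smallness in `k ^ 2 / p` thus beats
every power of `p`. -/
lemma DenseRegime.eventually_mul_log_le {k : ℕ → ℕ} (h : DenseRegime k) {L : ℝ} (hL : 0 < L) :
    ∀ᶠ p : ℕ in atTop, L * Real.log p ≤ (k p : ℝ) ^ 2 / p := by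
  have h1 := h.bound (show 0 < 1 / √L by positivity)
  filter_upwards [h1, eventually_ge_atTop 1] with p hp hp1
  have hp' : (1 : ℝ) ≤ p := by exact_mod_cast hp1
  have hlog : 0 ≤ Real.log p := Real.log_nonneg hp'
  rw [Real.norm_of_nonneg (Real.sqrt_nonneg _), Real.norm_of_nonneg (Nat.cast_nonneg _)] at hp
  have h2 := pow_le_pow_left₀ (Real.sqrt_nonneg _) hp 2
  rw [Real.sq_sqrt (by positivity), mul_pow, div_pow, Real.sq_sqrt hL.le, one_pow,
    one_div_mul_eq_div, le_div_iff₀ hL] at h2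
  rw [le_div_iff₀ (by linarith)]
  linarith

/-- In the dense regime the overlap stays typical for polynomially many steps. -/
lemma eventually_overlap_error_le {k : ℕ → ℕ} (h : DenseRegime k)
    (hk : ∀ᶠ p in atTop, 1 ≤ k p ∧ k p ≤ p) {t C : ℝ} (ht : 1 ≤ t) (hC : 0 < C) :
    ∀ᶠ p : ℕ in atTop, 16 / ((k p : ℝ) ^ 2 / p) +
      ⌊C * ((k p : ℝ) ^ (t + 1) / ((k p : ℝ) ^ 2 / p) ^ (t - 1) * p)⌋₊ *
        (6 / 7 : ℝ) ^ ((k p : ℝ) ^ 2 / p / 4 - 1 / 2) ≤ 1 / 6 := by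
  have hlim : ∀ᶠ p : ℕ in atTop, 24 * C ≤ (p : ℝ) :=
    tendsto_natCast_atTop_atTop.eventually_ge_atTop _
  -- The term `28 * (t + 3)` comes from `log (6/7) ≤ -1/7` and the exponent `ℓ / 4`; the summand
  -- `300` secures `ℓ ≥ 192`, that is `16 / ℓ ≤ 1/12`.
  filter_upwards [h.eventually_mul_log_le (show 0 < 28 * (t + 3) + 300 by linarith), hk, hlim,
    eventually_ge_atTop 2] with p hℓ hkp hpC hp2
  set ℓ := (k p : ℝ) ^ 2 / p with hℓdef
  have hp' : (2 : ℝ) ≤ p := by exact_mod_cast hp2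
  have hp0 : (0 : ℝ) < p := by linarith
  have hk' : (1 : ℝ) ≤ k p := by exact_mod_cast hkp.1
  have hkp' : (k p : ℝ) ≤ p := by exact_mod_cast hkp.2
  have hlog : Real.log 2 ≤ Real.log p := Real.log_le_log (by norm_num) hp'
  have hlog2 := Real.log_two_gt_d9
  have hℓ200 : 192 ≤ ℓ := by nlinarith
  have h1 : 16 / ℓ ≤ 1 / 12 := by
    rw [div_le_div_iff₀ (by linarith) (by norm_num)]
    linarith
  -- The factor `2` absorbs the shift `-1/2` in the exponent. The power `t + 3` is one more than the
  -- `p ^ (t + 2)` bounding the number of steps.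
  have h2 : (6 / 7 : ℝ) ^ (ℓ / 4 - 1 / 2) ≤ 2 * (p : ℝ) ^ (-(t + 3)) := by
    have e1 : Real.log (6 / 7) ≤ -(1 / 7) := by
      have := Real.log_le_sub_one_of_pos (show (0 : ℝ) < 6 / 7 by norm_num)
      linarith
    have e2 : Real.log (6 / 7) * (ℓ / 4 - 1 / 2) ≤ -(1 / 7) * (ℓ / 4 - 1 / 2) :=
      mul_le_mul_of_nonneg_right e1 (by linarith)
    have e3 : 28 * (t + 3) * Real.log p ≤ ℓ := by nlinarith
    rw [Real.rpow_def_of_pos (by norm_num), Real.rpow_def_of_pos hp0,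
      ← Real.exp_log (show (0 : ℝ) < 2 by norm_num), ← Real.exp_add]
    refine Real.exp_le_exp.2 ?_
    rw [Real.exp_log (show (0 : ℝ) < 2 by norm_num)]
    linarith
  have h3 : (k p : ℝ) ^ (t + 1) / ℓ ^ (t - 1) * p ≤ (p : ℝ) ^ (t + 2) := by
    have e1 : (k p : ℝ) ^ (t + 1) / ℓ ^ (t - 1) ≤ (k p : ℝ) ^ (t + 1) :=
      div_le_self (by positivity) (Real.one_le_rpow (by linarith) (by linarith))
    have e2 : (k p : ℝ) ^ (t + 1) ≤ (p : ℝ) ^ (t + 1) :=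
      Real.rpow_le_rpow (by linarith) hkp' (by linarith)
    have e3 : (p : ℝ) ^ (t + 2) = (p : ℝ) ^ (t + 1) * p := by
      rw [← Real.rpow_add_one hp0.ne']
      congr 1
      ring
    rw [e3]
    exact mul_le_mul_of_nonneg_right (e1.trans e2) hp0.le
  have h4 : ((⌊C * ((k p : ℝ) ^ (t + 1) / ℓ ^ (t - 1) * p)⌋₊ : ℕ) : ℝ) ≤
      C * (p : ℝ) ^ (t + 2) :=
    (Nat.floor_le (by positivity)).trans (mul_le_mul_of_nonneg_left h3 hC.le)
  have h5 := mul_le_mul h4 h2 (by positivity) (by positivity)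
  have h6 : C * (p : ℝ) ^ (t + 2) * (2 * (p : ℝ) ^ (-(t + 3))) = 2 * C / p := by
    have : (p : ℝ) ^ (t + 2) * (p : ℝ) ^ (-(t + 3)) = (p : ℝ)⁻¹ := by
      rw [← Real.rpow_add hp0, ← Real.rpow_neg_one]
      congr 1
      ring
    calc C * (p : ℝ) ^ (t + 2) * (2 * (p : ℝ) ^ (-(t + 3)))
        = 2 * C * ((p : ℝ) ^ (t + 2) * (p : ℝ) ^ (-(t + 3))) := by ring
      _ = 2 * C / p := by rw [this]; rfl
  have h7 : 2 * C / p ≤ 1 / 12 := by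
    rw [div_le_div_iff₀ hp0 (by norm_num)]
    linarith
  linarith

/-- For `k` bounded away from `p`, the quantity `k log (p / k)` is at least of order `log p`. -/
lemma mul_log_le_mul_log_div {k p η : ℝ} (hη : 0 < η) (hp : 1 ≤ p) (hk : 1 ≤ k)
    (hkp : k ≤ (1 - η) * p) : η / 2 * Real.log p ≤ k * Real.log (p / k) := by
  have hp0 : 0 < p := by linarith
  have hk0 : 0 < k := by linarith
  have hη1 : 0 < 1 - η := pos_of_mul_pos_left (by linarith : 0 < (1 - η) * p) hp0.le
  have hlog : 0 ≤ Real.log p := Real.log_nonneg hp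
  have hsq : Real.log √p = Real.log p / 2 := Real.log_sqrt hp0.le
  -- For `k ≤ √p` the logarithm is at least `log p / 2`; for `k ≥ √p` it is at least `η`, while `k`
  -- itself exceeds `log p / 2`.
  rcases le_total k √p with h | h
  · have h1 : Real.log k ≤ Real.log p / 2 := by
      rw [← hsq]
      exact Real.log_le_log hk0 h
    rw [Real.log_div hp0.ne' hk0.ne']
    nlinarith
  · have h1 : η ≤ Real.log (p / k) := by
      have h2 := Real.one_sub_inv_le_log_of_pos (div_pos hp0 hk0)
      rw [inv_div] at h2
      have h3 : k / p ≤ 1 - η := (div_le_iff₀ hp0).2 hkp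
      linarith
    have h4 : Real.log p / 2 ≤ k := by
      rw [← hsq]
      exact (Real.log_le_self (Real.sqrt_nonneg p)).trans h
    nlinarith

/-- A property that follows from the noise bounds for all large `p` holds with high
probability. -/
lemma withHighProbability_of_noiseBound {f : ℝ → ℝ} {ε t c M : ℝ} (h : LinkAssumption f ε t c M)
    (hε₀ : 0 < ε) (hε₁ : ε < 1) (hc : 0 < c) {d : ℕ → ℕ}
    {F : ∀ p, EuclideanSpace ℝ (Fin p) → EuclideanSpace ℝ (Fin (d p))}
    (hF : ∀ p, IsFeatureMap f (F p)) {k : ℕ → ℕ} (hk : ∀ᶠ p in atTop, 1 ≤ k p ∧ k p ≤ p)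
    {E : ∀ p, SparseSet p (k p) × EuclideanSpace ℝ (Fin (d p)) → Prop}
    (hE : ∀ᶠ p : ℕ in atTop, ∀ v W, NoiseBound (F p) v √(6 * M * k p * Real.log p)
      √(198 * (2 * M + 2 * M / ε) * Real.log p / k p) W → E p (v, W)) :
    WithHighProbability (fun p => law p (k p) (d p)) E := by
  have hlim : Tendsto (fun p : ℕ => ENNReal.ofReal (8 / p)) atTop (𝓝 0) := by
    rw [← ENNReal.ofReal_zero]
    exact ENNReal.tendsto_ofReal (tendsto_const_div_atTop_nhds_zero_nat 8)
  refine tendsto_of_tendsto_of_tendsto_of_le_of_le' tendsto_const_nhds hlim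
    (Eventually.of_forall fun _ => zero_le) ?_
  filter_upwards [hE, hk, eventually_ge_atTop 2] with p hEp hkp hp
  refine law_le_of_forall fun v => (measure_mono fun W hW => ?_).trans
    (measure_not_noiseBound_le h hε₀ hε₁ (h.bound_pos hε₀ hε₁ hc) (hF p) hkp.1 hp v)
  exact fun hbound => hW (hEp v W hbound)

/-- All three regimes follow from this statement because its number of steps does not involve `β`,
and its noise event serves all `β` at once. -/
lemma eventually_two_thirds_le_hitProb {f : ℝ → ℝ} {ε t c M : ℝ} (h : LinkAssumption f ε t c M)
    (hε₀ : 0 < ε) (hε₁ : ε < 1) (ht : 1 ≤ t) (hc : 0 < c) {d : ℕ → ℕ}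
    {F : ∀ p, EuclideanSpace ℝ (Fin p) → EuclideanSpace ℝ (Fin (d p))}
    (hF : ∀ p, IsFeatureMap f (F p)) {k : ℕ → ℕ} (hk : ∀ᶠ p in atTop, 1 ≤ k p ∧ k p ≤ p)
    (hreg : SparseRegime k ∨ DenseRegime k) {lam : ℕ → ℝ}
    (hlam : ∀ᶠ p : ℕ in atTop, (2 * √(198 * (2 * M + 2 * M / ε)) / signalConst ε t c +
      2 * √(6 * M)) * ((k p : ℝ) ^ (t - 1 / 2) / typicalOverlap k p ^ (t - 1) *
        √(Real.log p)) ≤ lam p) :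
    ∀ᶠ p : ℕ in atTop, 0 < lam p ∧ ∀ v W, NoiseBound (F p) v √(6 * M * k p * Real.log p)
      √(198 * (2 * M + 2 * M / ε) * Real.log p / k p) W →
      ∀ β : ℝ, (32 / signalConst ε t c + 2) *
          ((k p : ℝ) ^ t / typicalOverlap k p ^ (t - 1) * Real.log p) ≤ β * lam p →
        2 / 3 ≤ hitProb (uniformInit _) (metropolis (johnsonGraph p (k p))
          (hamiltonian (F p) (observation (F p) (lam p) v W)) β) v
          ⌊(48 * (M + 1) / signalConst ε t c + 2) *
            ((k p : ℝ) ^ (t + 1) / typicalOverlap k p ^ (t - 1) * p)⌋₊ := by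
  have hM := h.bound_pos hε₀ hε₁ hc
  have hκ : 0 < signalConst ε t c := signalConst_pos hε₀ hc
  set κ := signalConst ε t c with hκdef
  set A := 2 * M + 2 * M / ε with hA
  have hA0 : 0 < A := by positivity
  have hCT : 0 < 48 * (M + 1) / κ + 2 := by positivity
  have herr : ∀ᶠ p : ℕ in atTop, typicalOverlap k p = 1 ∨
      typicalOverlap k p = (k p : ℝ) ^ 2 / p ∧ 16 / typicalOverlap k p +
        ⌊(48 * (M + 1) / κ + 2) * ((k p : ℝ) ^ (t + 1) / typicalOverlap k p ^ (t - 1) * p)⌋₊ *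
          (6 / 7 : ℝ) ^ (typicalOverlap k p / 4 - 1 / 2) ≤ 1 / 6 := by
    rcases typicalOverlap_eq_one_or k with h1 | ⟨h1, h2⟩
    · exact Eventually.of_forall fun p => Or.inl (h1 p)
    · filter_upwards [eventually_overlap_error_le (hreg.resolve_left h1) hk ht hCT] with p hp
      refine Or.inr ⟨h2 p, ?_⟩
      rw [h2 p]
      exact hp
  filter_upwards [hk, hlam, herr, eventually_ge_atTop 2] with p hkp hlamp herrp hp
  have hp' : (2 : ℝ) ≤ p := by exact_mod_cast hp
  have hk1 : (1 : ℝ) ≤ k p := by exact_mod_cast hkp.1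
  have hk0 : (0 : ℝ) < k p := by linarith
  obtain ⟨hℓ, hℓk⟩ := typicalOverlap_pos_le hkp.1 hkp.2
  set ℓ := typicalOverlap k p with hℓdef
  have hlog : 0 < Real.log p := Real.log_pos (by linarith)
  have hℓt : 0 < ℓ ^ (t - 1) := Real.rpow_pos_of_pos hℓ _
  have hkt : 0 < (k p : ℝ) ^ t := Real.rpow_pos_of_pos hk0 _
  have hkt1 : 0 < (k p : ℝ) ^ (t - 1) := Real.rpow_pos_of_pos hk0 _
  have hℓkt : ℓ ^ (t - 1) ≤ (k p : ℝ) ^ (t - 1) :=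
    Real.rpow_le_rpow hℓ.le hℓk (by linarith)
  have hkt_half : (k p : ℝ) ^ (t - 1 / 2) = (k p : ℝ) ^ t / √(k p) := by
    rw [Real.rpow_sub hk0, Real.sqrt_eq_rpow]
  have hkt_half' : (k p : ℝ) ^ (t - 1 / 2) = (k p : ℝ) ^ (t - 1) * √(k p) := by
    rw [Real.sqrt_eq_rpow, ← Real.rpow_add hk0]
    congr 1
    ring
  set X := (k p : ℝ) ^ (t - 1 / 2) / ℓ ^ (t - 1) * √(Real.log p) with hX
  have hX0 : 0 < X :=
    mul_pos (div_pos (Real.rpow_pos_of_pos hk0 _) hℓt) (Real.sqrt_pos.2 hlog)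
  have hs0 : 0 ≤ 2 * √(198 * A) / κ := by positivity
  have hs1 : 0 ≤ 2 * √(6 * M) := by positivity
  -- The two summands of the constant play separate roles: the first makes half of the signal gain
  -- exceed `τ`, the second makes `lam p` at least twice the noise bound.
  have hlam1 : 2 * √(198 * A) / κ * X ≤ lam p := by nlinarith
  have hlam2 : 2 * √(6 * M) * X ≤ lam p := by nlinarith
  have hlam0 : 0 < lam p :=
    lt_of_lt_of_le (mul_pos (by positivity) hX0) hlam2
  refine ⟨hlam0, fun v W hW β hβ => ?_⟩
  refine two_thirds_le_hitProb_of_noiseBound h hε₀ hε₁ ht hc (hF p) hp hkp.1 hkp.2 hℓ hlam0 hW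
    ?_ ?_ ?_ ?_ herrp
  · refine le_trans ?_ hlam2
    have h1 : √(6 * M * k p * Real.log p) = √(6 * M) * (√(k p) * √(Real.log p)) := by
      rw [← Real.sqrt_mul hk0.le, ← Real.sqrt_mul (by positivity)]
      congr 1
      ring
    have h2 : √(k p) * √(Real.log p) ≤ X := by
      refine mul_le_mul_of_nonneg_right ?_ (Real.sqrt_nonneg _)
      rw [le_div_iff₀ hℓt, hkt_half', mul_comm]
      exact mul_le_mul_of_nonneg_right hℓkt (Real.sqrt_nonneg _)
    rw [h1, ← mul_assoc]
    exact mul_le_mul_of_nonneg_left h2 hs1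
  · have h1 : √(198 * A * Real.log p / k p) = √(198 * A) * (√(Real.log p) / √(k p)) := by
      rw [← Real.sqrt_div hlog.le, ← Real.sqrt_mul (by positivity)]
      congr 1
      ring
    have h2 : 2 * √(198 * A) / κ * X * (κ * ℓ ^ (t - 1) / (k p : ℝ) ^ t) / 2 =
        √(198 * A) * (√(Real.log p) / √(k p)) := by
      rw [hX, hkt_half]
      have : √(k p : ℝ) ≠ 0 := (Real.sqrt_pos.2 hk0).ne'
      field_simp
    rw [h1, ← h2]
    have h3 := mul_le_mul_of_nonneg_right hlam1
      (show 0 ≤ κ * ℓ ^ (t - 1) / (k p : ℝ) ^ t by positivity)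
    linarith
  · have h1 : 32 / κ * ((k p : ℝ) ^ t / ℓ ^ (t - 1) * Real.log p) ≤ β * lam p := by
      refine le_trans (mul_le_mul_of_nonneg_right ?_ (by positivity)) hβ
      linarith
    have h2 := mul_le_mul_of_nonneg_right h1
      (show 0 ≤ κ * ℓ ^ (t - 1) / (k p : ℝ) ^ t / 2 by positivity)
    have h3 : 32 / κ * ((k p : ℝ) ^ t / ℓ ^ (t - 1) * Real.log p) *
        (κ * ℓ ^ (t - 1) / (k p : ℝ) ^ t / 2) = 16 * Real.log p := by
      field_simp
      ring
    rw [h3] at h2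
    linarith
  -- As `K ≥ 1`, the extra `2` in the constant compensates for rounding down and makes the
  -- inequality strict.
  · set K := (k p : ℝ) ^ (t + 1) / ℓ ^ (t - 1) * p with hK
    have hK1 : 1 ≤ K := by
      have h1 : (k p : ℝ) ^ (t - 1) ≤ (k p : ℝ) ^ (t + 1) :=
        Real.rpow_le_rpow_of_exponent_le hk1 (by linarith)
      have h2 : 1 ≤ (k p : ℝ) ^ (t + 1) / ℓ ^ (t - 1) := by
        rw [le_div_iff₀ hℓt, one_mul]
        exact hℓkt.trans h1
      nlinarith
    have h3 := Nat.lt_floor_add_one ((48 * (M + 1) / κ + 2) * K)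
    nlinarith

end Asymptotic

end SparseGAM

end

open SparseGAM in
/-- The constants depend only on the constants of the assumption on the link function `f`; `Cβ'`
depends also on `η`, which keeps `k` away from `p` in the part where `log (p / k)` appears. -/
theorem theorem3p3 (ε t c M : ℝ) (hε₀ : 0 < ε) (hε₁ : ε < 1) (ht : 1 ≤ t) (hc : 0 < c) :
    ∃ (Clam Cβ CT : ℝ) (Cβ' : ℝ → ℝ), 0 < Clam ∧ 0 < Cβ ∧ 0 < CT ∧ (∀ η, 0 < η → 0 < Cβ' η) ∧
      ∀ (f : ℝ → ℝ), LinkAssumption f ε t c M →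
      ∀ (d : ℕ → ℕ) (F : ∀ p, EuclideanSpace ℝ (Fin p) → EuclideanSpace ℝ (Fin (d p))),
      (∀ p, IsFeatureMap f (F p)) →
      ∀ (k : ℕ → ℕ), (∀ᶠ p in atTop, 1 ≤ k p ∧ k p ≤ p) → SparseRegime k ∨ DenseRegime k →
      ∀ (lam : ℕ → ℝ),
      (∀ᶠ p in atTop, Clam * ((k p : ℝ) ^ (t - 1 / 2) / typicalOverlap k p ^ (t - 1) *
        √(Real.log p)) ≤ lam p) →
      -- low temperature
      (WithHighProbability (fun p => law p (k p) (d p)) fun p vW =>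
        ∀ β : ℝ, Cβ * ((k p : ℝ) ^ t / typicalOverlap k p ^ (t - 1) * Real.log p) ≤ β * lam p →
          2 / 3 ≤ hitProb (uniformInit _)
            (metropolis (johnsonGraph p (k p))
              (hamiltonian (F p) (observation (F p) (lam p) vW.1 vW.2)) β)
            vW.1 ⌊CT * (β * lam p * (k p : ℝ) ^ 2 * p)⌋₊) ∧
      -- very low temperature
      (∀ η : ℝ, 0 < η → (∀ᶠ p : ℕ in atTop, (k p : ℝ) ≤ (1 - η) * p) →
        WithHighProbability (fun p => law p (k p) (d p)) fun p vW =>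
        ∀ β : ℝ, Cβ' η * ((k p : ℝ) ^ (t + 1) / typicalOverlap k p ^ (t - 1) *
            Real.log ((p : ℝ) / k p)) ≤ β * lam p →
          2 / 3 ≤ hitProb (uniformInit _)
            (metropolis (johnsonGraph p (k p))
              (hamiltonian (F p) (observation (F p) (lam p) vW.1 vW.2)) β)
            vW.1 ⌊CT * ((k p : ℝ) ^ (t + 1) / typicalOverlap k p ^ (t - 1) * p)⌋₊) ∧
      -- zero temperature
      (WithHighProbability (fun p => law p (k p) (d p)) fun p vW =>
        2 / 3 ≤ hitProb (uniformInit _)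
          (randomizedGreedy (johnsonGraph p (k p))
            (hamiltonian (F p) (observation (F p) (lam p) vW.1 vW.2)))
          vW.1 ⌊CT * ((k p : ℝ) ^ (t + 1) / typicalOverlap k p ^ (t - 1) * p)⌋₊) := by
  -- The constants are chosen before `f`, when `M > 0` is not yet known, so `M` is enlarged to a
  -- positive bound.
  obtain ⟨M', hMM', hM'⟩ : ∃ M', M ≤ M' ∧ 0 < M' :=
    ⟨max M 1, le_max_left _ _, lt_of_lt_of_le one_pos (le_max_right _ _)⟩
  have hκ : 0 < signalConst ε t c := signalConst_pos hε₀ hc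
  have hCβ : 0 < 32 / signalConst ε t c + 2 := by positivity
  refine ⟨2 * √(198 * (2 * M' + 2 * M' / ε)) / signalConst ε t c + 2 * √(6 * M'),
    32 / signalConst ε t c + 2, 48 * (M' + 1) / signalConst ε t c + 2,
    fun η => 2 / η * (32 / signalConst ε t c + 2), by positivity, hCβ, by positivity,
    fun η hη => by positivity, ?_⟩
  intro f hf d F hF k hk hreg lam hlam
  have hf' := hf.mono hMM'
  have hcore := eventually_two_thirds_le_hitProb hf' hε₀ hε₁ ht hc hF hk hreg hlam
  set κ := signalConst ε t c with hκdef
  refine ⟨?_, fun η hη hkη => ?_, ?_⟩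
  · refine withHighProbability_of_noiseBound hf' hε₀ hε₁ hc hF hk ?_
    filter_upwards [hcore, hk, eventually_ge_atTop 2] with p hp hkp hp2 v W hW β hβ
    refine (hp.2 v W hW β hβ).trans (hitProb_mono uniformInit_nonneg
      (metropolis_isStochastic _ _ _) v (Nat.floor_mono ?_))
    refine mul_le_mul_of_nonneg_left ?_ (by positivity)
    have hp' : (2 : ℝ) ≤ p := by exact_mod_cast hp2
    have hk1 : (1 : ℝ) ≤ k p := by exact_mod_cast hkp.1
    have hk0 : (0 : ℝ) < k p := by linarith
    have hℓt : 0 < typicalOverlap k p ^ (t - 1) :=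
      Real.rpow_pos_of_pos (typicalOverlap_pos_le hkp.1 hkp.2).1 _
    have hlog : Real.log 2 ≤ Real.log p := Real.log_le_log (by norm_num) hp'
    have hlog2 := Real.log_two_gt_d9
    set Q := (k p : ℝ) ^ t / typicalOverlap k p ^ (t - 1) with hQ
    have hQ0 : 0 < Q := div_pos (Real.rpow_pos_of_pos hk0 _) hℓt
    -- Hence `Q * k p * p` is at most `β * lam p * k p ^ 2 * p`: the allotted time exceeds the one
    -- already sufficient, and hitting probabilities increase with time.
    have h1 : Q ≤ β * lam p := by
      refine le_trans ?_ hβ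
      have h2 : 1 ≤ (32 / κ + 2) * Real.log p := by
        have : 0 < 32 / κ := by positivity
        nlinarith
      nlinarith
    have h3 : (k p : ℝ) ^ (t + 1) / typicalOverlap k p ^ (t - 1) = Q * k p := by
      rw [hQ, Real.rpow_add_one hk0.ne']
      ring
    rw [h3]
    refine mul_le_mul_of_nonneg_right ?_ (by positivity)
    exact mul_le_mul h1 (by nlinarith) hk0.le (hQ0.le.trans h1)
  · refine withHighProbability_of_noiseBound hf' hε₀ hε₁ hc hF hk ?_
    filter_upwards [hcore, hk, hkη, eventually_ge_atTop 2] with p hp hkp hkηp hp2 v W hW β hβ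
    refine hp.2 v W hW β (le_trans ?_ hβ)
    have hp' : (2 : ℝ) ≤ p := by exact_mod_cast hp2
    have hk1 : (1 : ℝ) ≤ k p := by exact_mod_cast hkp.1
    have hk0 : (0 : ℝ) < k p := by linarith
    have hℓt : 0 < typicalOverlap k p ^ (t - 1) :=
      Real.rpow_pos_of_pos (typicalOverlap_pos_le hkp.1 hkp.2).1 _
    set Q := (k p : ℝ) ^ t / typicalOverlap k p ^ (t - 1) with hQ
    have hQ0 : 0 < Q := div_pos (Real.rpow_pos_of_pos hk0 _) hℓt
    have h1 := mul_log_le_mul_log_div hη (by linarith : (1 : ℝ) ≤ p) hk1 hkηp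
    have h3 : (k p : ℝ) ^ (t + 1) / typicalOverlap k p ^ (t - 1) = Q * k p := by
      rw [hQ, Real.rpow_add_one hk0.ne']
      ring
    calc (32 / κ + 2) * (Q * Real.log p)
        = 2 / η * (32 / κ + 2) * (Q * (η / 2 * Real.log p)) := by field_simp
      _ ≤ 2 / η * (32 / κ + 2) * (Q * (k p * Real.log (p / k p))) :=
          mul_le_mul_of_nonneg_left (mul_le_mul_of_nonneg_left h1 hQ0.le) (by positivity)
      _ = _ := by rw [h3, mul_assoc Q]
  · refine withHighProbability_of_noiseBound hf' hε₀ hε₁ hc hF hk ?_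
    filter_upwards [hcore] with p hp v W hW
    -- The noise event and the number of steps are fixed while `β → ∞`, and the hitting probability
    -- is continuous in the transition matrix. Since `lam p > 0`, all large `β` meet the temperature
    -- condition.
    refine ge_of_tendsto (((continuous_hitProb _ _ v).tendsto _).comp
      (tendsto_metropolis_atTop _ _)) ?_
    filter_upwards [(tendsto_id.atTop_mul_const hp.1).eventually_ge_atTop _] with β hβ
    exact hp.2 v W hW β hβ
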